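/- Let $n\ge 1$. For $s\in(0,1)$, an open set $\Omega\subset\mathbb R^n$ and a measurable set $E\subset\mathbb R^n$, let $$\operatorname{Per}_s(E;\Omega)=c_{n,s}\left(\int_{E^c\cap\Omega}\int_{E\cap\Omega}+\int_{E\cap\Omega}\int_{E^c\cap\Omega^c}+\int_{E\cap\Omega^c}\int_{E^c\cap\Omega}\right)\frac{dx\,dy}{|x-y|^{n+s}},\qquad c_{n,s}=\frac{2^{2+2s}\,\Gamma\left(\frac{n+s}{2}\right)}{\pi^{n/2}\,\Gamma(2-s)}\,s(1-s).$$ If $\Omega$ has $C^1$ boundary, $\partial E$ is called a free boundary $s$-minimal hypersurface in $\Omega$ if, for every vector field $\mathcal X\in C^\infty_c(\mathbb R^n,\mathbb R^n)$ with $\mathcal X(x)\in T_x(\partial\Omega)$ for all $x\in\partial\Omega$, with flow $\Phi_t$ ($\partial_t\Phi_t=\mathcal X\circ\Phi_t$, $\Phi_0=\mathrm{id}$), the function $t\mapsto \operatorname{Per}_s(\Phi_t(E);\Omega)$ is finite near $t=0$, differentiable at $t=0$, and $$\frac{d}{dt}\Big|_{t=0}\operatorname{Per}_s(\Phi_t(E);\Omega)=0.$$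 Let $B_r\subset\mathbb R^n$ denote the open ball of radius $r$ centred at the origin. **Theorem.** There exists $s_\circ\in(0,1)$ such that for every $s\in(0,s_\circ)$ there exist radii $0<r_1<1<r_2$ such that $\partial(B_{r_2}\setminus B_{r_1})$ is a free boundary $s$-minimal hypersurface in $B_1$. In particular, this radially symmetric hypersurface has no contact with the boundary of the reference domain: $\partial(B_{r_2}\setminus B_{r_1})\cap\partial B_1=\varnothing$. -/

import Mathlib

open MeasureTheory Metric
open scoped ContDiff Topology

noncomputable section

/-- The normalising constant
`c_{n,s} = 2^(2+2s) Γ((n+s)/2) s (1-s) / (π^(n/2) Γ(2-s))`. -/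
def fracConst (n : ℕ) (s : ℝ) : ℝ :=
  (2 : ℝ) ^ (2 + 2 * s) * Real.Gamma ((n + s) / 2) /
    (Real.pi ^ ((n : ℝ) / 2) * Real.Gamma (2 - s)) * (s * (1 - s))

/-- The interaction `∫_A ∫_B |x - y|^{-(n+s)} dx dy` of two (measurable) subsets of `ℝⁿ`,
as an extended nonnegative number. -/
def fracInteraction {n : ℕ} (s : ℝ) (A B : Set (EuclideanSpace ℝ (Fin n))) : ENNReal :=
  ∫⁻ y in A, ∫⁻ x in B, ENNReal.ofReal (1 / ‖x - y‖ ^ ((n : ℝ) + s))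

/-- The `s`-fractional perimeter `Per_s(E; Ω)` of a (measurable) set `E ⊆ ℝⁿ` in an open set `Ω`,
as an extended nonnegative number. -/
def fracPerimeter {n : ℕ} (s : ℝ) (E Ω : Set (EuclideanSpace ℝ (Fin n))) : ENNReal :=
  ENNReal.ofReal (fracConst n s) *
    (fracInteraction s (Eᶜ ∩ Ω) (E ∩ Ω) + fracInteraction s (E ∩ Ω) (Eᶜ ∩ Ωᶜ) +
      fracInteraction s (E ∩ Ωᶜ) (Eᶜ ∩ Ω))

/-- `X` is an admissible vector field for `Ω`: it belongs to `C_c^∞(ℝⁿ, ℝⁿ)` and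
`X x ∈ T_x(∂Ω)` for every `x ∈ ∂Ω`. When `∂Ω` is a `C¹` hypersurface, the tangent cone of `∂Ω`
at `x` is the tangent space `T_x(∂Ω)` (which is `{0}` when `n = 1`). -/
structure IsTangentialField {n : ℕ} (Ω : Set (EuclideanSpace ℝ (Fin n)))
    (X : EuclideanSpace ℝ (Fin n) → EuclideanSpace ℝ (Fin n)) : Prop where
  smooth : ContDiff ℝ ∞ X
  hasCompactSupport : HasCompactSupport X
  tangent : ∀ x ∈ frontier Ω, X x ∈ tangentConeAt ℝ (frontier Ω) x

/-- `Φ` is the flow of the vector field `X`: `∂_t Φ_t = X ∘ Φ_t` for all times and `Φ_0 = id`. -/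
structure IsFlowOf {n : ℕ} (X : EuclideanSpace ℝ (Fin n) → EuclideanSpace ℝ (Fin n))
    (Φ : ℝ → EuclideanSpace ℝ (Fin n) → EuclideanSpace ℝ (Fin n)) : Prop where
  initial : ∀ x, Φ 0 x = x
  hasDerivAt : ∀ t x, HasDerivAt (fun τ => Φ τ x) (X (Φ t x)) t

/-- `∂E` is a (nonlocal) free boundary `s`-minimal hypersurface in `Ω`, an open set with `C¹`
boundary: for every `X ∈ C_c^∞(ℝⁿ, ℝⁿ)` tangent to `∂Ω`, with flow `Φ`, the function
`t ↦ Per_s(Φ_t(E); Ω)` is finite for `t` near `0` and has derivative `0` at `t = 0`. -/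
def IsFreeBoundaryMinimal {n : ℕ} (s : ℝ) (Ω E : Set (EuclideanSpace ℝ (Fin n))) : Prop :=
  ∀ X Φ, IsTangentialField Ω X → IsFlowOf X Φ →
    (∀ᶠ t in 𝓝 (0 : ℝ), fracPerimeter s (Φ t '' E) Ω ≠ ⊤) ∧
      HasDerivAt (fun t => (fracPerimeter s (Φ t '' E) Ω).toReal) 0 0

end

open MeasureTheory Metric
open scoped ContDiff Topology

noncomputable section

/-! Write `A` and `B` for the images under the flow of the inner and outer balls, and `Ω` for the
unit ball. For small times `A ⊆ Ω ⊆ B` with gaps, so the perimeter of `B \ A` in `Ω` is the sum of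
the interactions of `A` with `Ω \ A`, of `Ω \ A` with `Bᶜ` and of `B \ Ω` with `A`. A potential
generated by a centred ball is constant on centred spheres. Hence, for every vector field, the first
variation depends only on the volume changes of `A` and `B`, and criticality reduces to two scalar
equations for the radii.

To differentiate despite the singular kernel, the kernel is split at distance `ε`. The bounded part
has a bilinear energy whose first variation is explicit
(`LipschitzFlow.truncPerimeter_sub_isLittleO`). The singular part sees only `A` against its
complement (`fracPerimeter_annular`). It changes by at most a constant times `|t|` times the
interaction at distances below `4 * ε` (`abs_interaction_singKer_sub_le`), and this factor tends to
`0` with `ε` because balls have finite fractional perimeter. Fixing a small `ε` and then letting `t`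
tend to `0` gives the derivative.

The equations are as follows. At the outer sphere, the potential of the unit ball is twice that of
the inner ball. At the inner sphere, the curvature of the inner ball is twice the potential of the
complement of the outer ball. Normalise the inner radius to `1`. The second equation gives an outer
radius `ρ`, the first then gives a reference radius `τ` with `1 < τ < ρ`, both by the intermediate
value theorem, and a dilation by `τ⁻¹` makes the reference ball the unit ball
(`exists_critical_radii`). The curvature of a ball needs no principal value: it is read off from the
scaling of perimeter and volume under dilations (`tendsto_truncCurvature`). -/

/-- Euclidean `n`-space. -/
abbrev Euc (n : ℕ) := EuclideanSpace ℝ (Fin n)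

/-! ### Interactions and their behaviour under bi-Lipschitz maps. -/

/-- The interaction of two sets through a radial kernel with profile `k`. -/
def interaction {n : ℕ} (k : ℝ → ENNReal) (U V : Set (Euc n)) : ENNReal :=
  ∫⁻ y in U, ∫⁻ x in V, k ‖x - y‖

/-- Lebesgue measure is a multiple of `n`-dimensional Hausdorff measure, for which the Lipschitz
bound is standard. No Jacobian is needed here or later. -/
theorem volume_image_le {n : ℕ} {T : Euc n → Euc n} {K : NNReal} (hT : LipschitzWith K T)
    (U : Set (Euc n)) : volume (T '' U) ≤ (K : ENNReal) ^ n * volume U := by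
  have h := (hT.lipschitzOnWith (s := U)).hausdorffMeasure_image_le (d := (n : ℝ)) (by positivity)
  have hv : (volume : Measure (Euc n)) = _ :=
    Measure.isAddLeftInvariant_eq_smul (volume : Measure (Euc n)) (Measure.hausdorffMeasure (n : ℝ))
  rw [hv]
  simp only [Measure.smul_apply, ENNReal.smul_def, smul_eq_mul]
  rw [mul_left_comm]
  gcongr
  simpa using h

/-- The volume bound says that the pushforward of volume under the inverse map `S` is at most `K ^
n` times volume. This one-sided estimate replaces the change of variables formula. -/
theorem lintegral_image_le {n : ℕ} {T S : Euc n → Euc n} {K : NNReal} (hT : LipschitzWith K T)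
    (hS : Continuous S) (hTS : ∀ x, T (S x) = x) (hST : ∀ x, S (T x) = x)
    {U : Set (Euc n)} (hU : MeasurableSet U) {φ : Euc n → ENNReal} (hφ : Measurable φ) :
    ∫⁻ y in T '' U, φ y ≤ (K : ENNReal) ^ n * ∫⁻ x in U, φ (T x) := by
  have him : ∀ W : Set (Euc n), T '' W = S ⁻¹' W := fun W =>
    congrFun (Set.image_eq_preimage_of_inverse hST hTS) W
  have hle : (volume : Measure (Euc n)).map S ≤ (K : ENNReal) ^ n • volume := by
    refine Measure.le_iff.2 fun W hW => ?_
    rw [Measure.map_apply hS.measurable hW, ← him]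
    simpa using volume_image_le hT W
  calc ∫⁻ y in T '' U, φ y = ∫⁻ y in S ⁻¹' U, φ (T (S y)) := by simp_rw [hTS, him]
    _ = ∫⁻ x in U, φ (T x) ∂((volume : Measure (Euc n)).map S) :=
        (setLIntegral_map hU (hφ.comp hT.continuous.measurable) hS.measurable).symm
    _ ≤ ∫⁻ x in U, φ (T x) ∂((K : ENNReal) ^ n • volume) :=
        lintegral_mono' (Measure.restrict_mono subset_rfl hle) le_rfl
    _ = _ := by rw [Measure.restrict_smul, lintegral_smul_measure, smul_eq_mul]

theorem measurable_kernel {n : ℕ} {k : ℝ → ENNReal} (hk : Measurable k) :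
    Measurable fun q : Euc n × Euc n => k ‖q.2 - q.1‖ := by fun_prop

theorem measurable_kernel_left {n : ℕ} {k : ℝ → ENNReal} (hk : Measurable k) (y : Euc n) :
    Measurable fun x : Euc n => k ‖x - y‖ := by fun_prop

theorem measurable_lintegral_kernel {n : ℕ} {k : ℝ → ENNReal} (hk : Measurable k)
    (V : Set (Euc n)) : Measurable fun y : Euc n => ∫⁻ x in V, k ‖x - y‖ :=
  (measurable_kernel hk).lintegral_prod_right'

theorem interaction_image_le {n : ℕ} {T S : Euc n → Euc n} {K : NNReal} (hT : LipschitzWith K T)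
    (hS : Continuous S) (hTS : ∀ x, T (S x) = x) (hST : ∀ x, S (T x) = x)
    {U V : Set (Euc n)} (hU : MeasurableSet U) (hV : MeasurableSet V) {k k' : ℝ → ENNReal}
    (hk : Measurable k) (h : ∀ y ∈ U, ∀ x ∈ V, k ‖T x - T y‖ ≤ k' ‖x - y‖) :
    interaction k (T '' U) (T '' V) ≤ (K : ENNReal) ^ (2 * n) * interaction k' U V := by
  unfold interaction
  calc _ ≤ (K : ENNReal) ^ n * ∫⁻ y in U, ∫⁻ x in T '' V, k ‖x - T y‖ :=
        lintegral_image_le hT hS hTS hST hU (measurable_lintegral_kernel hk _)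
    _ ≤ (K : ENNReal) ^ n * ∫⁻ y in U, (K : ENNReal) ^ n * ∫⁻ x in V, k' ‖x - y‖ := by
        refine mul_le_mul' le_rfl ?_
        refine setLIntegral_mono' hU fun y hy => ?_
        refine (lintegral_image_le hT hS hTS hST hV (measurable_kernel_left hk _)).trans ?_
        refine mul_le_mul' le_rfl ?_
        exact setLIntegral_mono' hV fun x hx => h y hy x hx
    _ = _ := by
        rw [lintegral_const_mul' _ _ (by simp), ← mul_assoc, ← pow_add, two_mul]

theorem interaction_comm {n : ℕ} {k : ℝ → ENNReal} (hk : Measurable k) (U V : Set (Euc n)) :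
    interaction k U V = interaction k V U := by
  unfold interaction
  rw [lintegral_lintegral_swap (by fun_prop)]
  simp_rw [norm_sub_rev]

theorem interaction_congr {n : ℕ} {k k' : ℝ → ENNReal} {U V : Set (Euc n)}
    (hU : MeasurableSet U) (hV : MeasurableSet V)
    (h : ∀ y ∈ U, ∀ x ∈ V, k ‖x - y‖ = k' ‖x - y‖) : interaction k U V = interaction k' U V :=
  setLIntegral_congr_fun hU fun y hy => setLIntegral_congr_fun hV fun x hx => h y hy x hx

theorem interaction_mono {n : ℕ} {k k' : ℝ → ENNReal} {U V : Set (Euc n)}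
    (hU : MeasurableSet U) (hV : MeasurableSet V)
    (h : ∀ y ∈ U, ∀ x ∈ V, k ‖x - y‖ ≤ k' ‖x - y‖) : interaction k U V ≤ interaction k' U V :=
  setLIntegral_mono' hU fun y hy => setLIntegral_mono' hV fun x hx => h y hy x hx

theorem interaction_add {n : ℕ} {k k' : ℝ → ENNReal} (hk : Measurable k) (U V : Set (Euc n)) :
    interaction (fun r => k r + k' r) U V = interaction k U V + interaction k' U V := by
  unfold interaction
  rw [← lintegral_add_left (measurable_lintegral_kernel hk V)]
  refine lintegral_congr fun y => ?_
  rw [lintegral_add_left (measurable_kernel_left hk y)]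

theorem interaction_const_mul {n : ℕ} {k : ℝ → ENNReal} {c : ENNReal} (hc : c ≠ ⊤)
    (U V : Set (Euc n)) : interaction (fun r => c * k r) U V = c * interaction k U V := by
  unfold interaction
  simp_rw [lintegral_const_mul' c _ hc]

theorem interaction_union_right {n : ℕ} {k : ℝ → ENNReal} (hk : Measurable k) (U : Set (Euc n))
    {V W : Set (Euc n)} (hW : MeasurableSet W) (hVW : Disjoint V W) :
    interaction k U (V ∪ W) = interaction k U V + interaction k U W := by
  unfold interaction
  rw [← lintegral_add_left (measurable_lintegral_kernel hk V)]
  exact lintegral_congr fun y => lintegral_union hW hVW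

/-! ### Flows: vector fields and dilations treated together. -/

/-- One-parameter families of homeomorphisms with the Lipschitz and displacement bounds of the
flow of a vector field. -/
structure LipschitzFlow {n : ℕ} (L : ℝ) (T : ℝ → Euc n → Euc n) : Prop where
  nonneg : 0 ≤ L
  right_inv : ∀ t x, T t (T (-t) x) = x
  lip : ∀ t x y, ‖T t x - T t y‖ ≤ Real.exp (L * |t|) * ‖x - y‖
  disp : ∀ t x, |t| ≤ 1 → ‖T t x - x‖ ≤ L * |t| * (1 + ‖x‖)

namespace LipschitzFlow

variable {n : ℕ} {L : ℝ} {T : ℝ → Euc n → Euc n}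

theorem left_inv (hT : LipschitzFlow L T) (t : ℝ) (x : Euc n) : T (-t) (T t x) = x := by
  simpa using hT.right_inv (-t) x

theorem lipschitzWith (hT : LipschitzFlow L T) (t : ℝ) :
    LipschitzWith (Real.exp (L * |t|)).toNNReal (T t) :=
  LipschitzWith.of_dist_le_mul fun x y => by
    rw [Real.coe_toNNReal _ (Real.exp_pos _).le, dist_eq_norm, dist_eq_norm]
    exact hT.lip t x y

theorem image_eq_preimage (hT : LipschitzFlow L T) (t : ℝ) (U : Set (Euc n)) :
    T t '' U = T (-t) ⁻¹' U :=
  congrFun (Set.image_eq_preimage_of_inverse (hT.left_inv t) (hT.right_inv t)) U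

theorem measurableSet_image (hT : LipschitzFlow L T) (t : ℝ) {U : Set (Euc n)}
    (hU : MeasurableSet U) : MeasurableSet (T t '' U) := by
  rw [hT.image_eq_preimage]
  exact (hT.lipschitzWith (-t)).continuous.measurable hU

theorem image_compl (hT : LipschitzFlow L T) (t : ℝ) (U : Set (Euc n)) :
    T t '' Uᶜ = (T t '' U)ᶜ := by
  simp [hT.image_eq_preimage]

theorem image_image (hT : LipschitzFlow L T) (t : ℝ) (U : Set (Euc n)) :
    T (-t) '' (T t '' U) = U := by
  simp [Set.image_image, hT.left_inv]

theorem antilip (hT : LipschitzFlow L T) (t : ℝ) (x y : Euc n) :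
    ‖x - y‖ ≤ Real.exp (L * |t|) * ‖T t x - T t y‖ := by
  simpa [hT.left_inv] using hT.lip (-t) (T t x) (T t y)

/-- The image of a centred ball differs from the ball only in a thin shell. -/
theorem mem_shell (hT : LipschitzFlow L T) {t r : ℝ} (ht : |t| ≤ 1) {x : Euc n}
    (hx : x ∈ symmDiff (T t '' ball 0 r) (ball 0 r)) : |‖x‖ - r| ≤ L * (1 + r) * |t| := by
  have h0 := hT.nonneg
  rcases hx with ⟨⟨y, hy, rfl⟩, hx⟩ | ⟨hx, hx'⟩
  · rw [mem_ball_zero_iff] at hx hy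
    have h1 := hT.disp t y ht
    have h2 := norm_sub_norm_le (T t y) y
    have h3 : L * |t| * (1 + ‖y‖) ≤ L * |t| * (1 + r) := by gcongr
    rw [abs_le]; constructor <;> nlinarith [abs_nonneg t]
  · rw [hT.image_eq_preimage, Set.mem_preimage, mem_ball_zero_iff] at hx'
    rw [mem_ball_zero_iff] at hx
    have h1 := hT.disp (-t) x (by simpa using ht)
    rw [abs_neg] at h1
    have h2 := norm_sub_norm_le (T (-t) x) x
    have h3 : L * |t| * (1 + ‖x‖) ≤ L * |t| * (1 + r) := by gcongr
    rw [abs_le]; constructor <;> nlinarith [abs_nonneg t]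

end LipschitzFlow

/-- Dilations are not generated by a compactly supported field. They are the reason for the factor
`1 + ‖x‖` in the displacement bound, and they serve to compute the curvature of the unit ball. -/
theorem lipschitzFlow_exp_smul (n : ℕ) :
    LipschitzFlow 2 (fun (t : ℝ) (x : Euc n) => Real.exp t • x) where
  nonneg := by norm_num
  right_inv t x := by simp [smul_smul, ← Real.exp_add]
  lip t x y := by
    rw [← smul_sub, norm_smul, Real.norm_eq_abs, Real.abs_exp]
    gcongr
    linarith [le_abs_self t, abs_nonneg t]
  disp t x ht := by
    have : Real.exp t • x - x = (Real.exp t - 1) • x := by rw [sub_smul, one_smul]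
    rw [this, norm_smul, Real.norm_eq_abs]
    have := Real.abs_exp_sub_one_le ht
    gcongr
    linarith

/-- Grönwall's inequality gives the Lipschitz bound, for negative times by passing to `-X`.
Uniqueness for the ODE gives the inverse, and the boundedness of `X` gives the displacement bound.
-/
theorem IsFlowOf.exists_lipschitzFlow {n : ℕ} {X : Euc n → Euc n} {Φ : ℝ → Euc n → Euc n}
    (hX : ContDiff ℝ ∞ X) (hc : HasCompactSupport X) (hΦ : IsFlowOf X Φ) :
    ∃ L, LipschitzFlow L Φ := by
  obtain ⟨K, hK⟩ := ContDiff.lipschitzWith_of_hasCompactSupport hc hX (by simp)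
  obtain ⟨C, hC⟩ := hc.exists_bound_of_continuous hX.continuous
  have hC0 : 0 ≤ C := (norm_nonneg _).trans (hC 0)
  have hneg : ∀ t x, HasDerivAt (fun τ => Φ (-τ) x) (-X (Φ (-t) x)) t := fun t x => by
    have := (hΦ.hasDerivAt (-t) x).scomp t (hasDerivAt_neg t)
    rw [neg_one_smul] at this
    exact this
  have key : ∀ (v : Euc n → Euc n) (Ψ : ℝ → Euc n → Euc n), LipschitzWith K v →
      (∀ x, Ψ 0 x = x) → (∀ t x, HasDerivAt (fun τ => Ψ τ x) (v (Ψ t x)) t) →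
      ∀ t, 0 ≤ t → ∀ x y, ‖Ψ t x - Ψ t y‖ ≤ ‖x - y‖ * Real.exp (K * t) := by
    intro v Ψ hv h0 hd t ht x y
    have := dist_le_of_trajectories_ODE (v := fun _ => v) (K := K) (f := fun τ => Ψ τ x)
      (g := fun τ => Ψ τ y) (a := 0) (b := t) (δ := ‖x - y‖) (fun _ => hv)
      (fun τ _ => (hd τ x).continuousAt.continuousWithinAt)
      (fun τ _ => (hd τ x).hasDerivWithinAt)
      (fun τ _ => (hd τ y).continuousAt.continuousWithinAt)
      (fun τ _ => (hd τ y).hasDerivWithinAt) (by simp [h0, dist_eq_norm]) t ⟨ht, le_rfl⟩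
    simpa [dist_eq_norm] using this
  refine ⟨K + C, by positivity, ?_, ?_, ?_⟩
  · intro t x
    have h := ODE_solution_unique_univ (v := fun _ => X) (s := fun _ => Set.univ) (K := K)
      (f := fun τ => Φ τ (Φ (-t) x)) (g := fun τ => Φ (τ - t) x) (t₀ := 0)
      (fun _ => hK.lipschitzOnWith) (fun τ => ⟨hΦ.hasDerivAt τ _, trivial⟩)
      (fun τ => ⟨?_, trivial⟩) (by simp [hΦ.initial])
    · simpa [hΦ.initial] using congrFun h t
    · exact (hΦ.hasDerivAt (τ - t) x).comp_sub_const τ t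
  · intro t x y
    have h1 : ‖Φ t x - Φ t y‖ ≤ ‖x - y‖ * Real.exp (K * |t|) := by
      rcases le_total 0 t with ht | ht
      · simpa [abs_of_nonneg ht] using key X Φ hK hΦ.initial hΦ.hasDerivAt t ht x y
      · have := key (fun x => -X x) (fun τ => Φ (-τ)) hK.neg (by simpa using hΦ.initial) hneg (-t)
          (by linarith) x y
        simpa [abs_of_nonpos ht] using this
    refine h1.trans ?_
    rw [mul_comm]
    gcongr
    linarith
  · intro t x _
    have h1 := Convex.norm_image_sub_le_of_norm_hasDerivWithin_le (f := fun τ => Φ τ x)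
      (f' := fun τ => X (Φ τ x)) (s := Set.univ) (C := C) (x := 0) (y := t)
      (fun τ _ => (hΦ.hasDerivAt τ x).hasDerivWithinAt) (fun τ _ => hC _) convex_univ trivial trivial
    simp only [hΦ.initial, sub_zero, Real.norm_eq_abs] at h1
    refine h1.trans ?_
    have : 0 ≤ ((K : ℝ) * |t| + (K + C) * |t| * ‖x‖) := by positivity
    nlinarith

/-! ### Splitting the kernel into a bounded and a singular part. -/

/-- The profile `r ↦ r ^ (-p)` of the singular kernel. -/
def fracKer (p r : ℝ) : ENNReal := ENNReal.ofReal (1 / r ^ p)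

/-- The profile of the singular kernel truncated at distance `ε`. -/
def truncKer (p ε r : ℝ) : ℝ := 1 / (max r ε) ^ p

/-- The part of the singular kernel that the truncation removes. -/
def singKer (p ε r : ℝ) : ENNReal := ENNReal.ofReal (1 / r ^ p - 1 / ε ^ p)

/-- The singular kernel restricted to distances less than `ε`. -/
def nearKer (p ε : ℝ) : ℝ → ENNReal := (Set.Iio ε).indicator (fracKer p)

theorem measurable_fracKer (p : ℝ) : Measurable (fracKer p) := by
  unfold fracKer; fun_prop

theorem measurable_truncKer (p ε : ℝ) : Measurable (truncKer p ε) := by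
  unfold truncKer; fun_prop

theorem measurable_singKer (p ε : ℝ) : Measurable (singKer p ε) := by
  unfold singKer; fun_prop

theorem measurable_nearKer (p ε : ℝ) : Measurable (nearKer p ε) :=
  (measurable_fracKer p).indicator measurableSet_Iio

theorem fracInteraction_eq {n : ℕ} (s : ℝ) (U V : Set (Euc n)) :
    fracInteraction s U V = interaction (fracKer (n + s)) U V := rfl

section Profiles

variable {p ε r : ℝ}

theorem truncKer_of_le (h : ε ≤ r) : truncKer p ε r = 1 / r ^ p := by
  rw [truncKer, max_eq_left h]

theorem singKer_of_le (hp : 0 ≤ p) (hε : 0 < ε) (h : ε ≤ r) : singKer p ε r = 0 := by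
  refine ENNReal.ofReal_of_nonpos (sub_nonpos.2 ?_)
  exact one_div_le_one_div_of_le (Real.rpow_pos_of_pos hε p) (Real.rpow_le_rpow hε.le h hp)

/-- Positivity of `r` matters: at `r = 0` the default `1 / 0 = 0` makes `fracKer` vanish while
`truncKer` does not. Later uses concern disjoint sets, where distances are positive. -/
theorem fracKer_eq_add (hp : 0 ≤ p) (hε : 0 < ε) (hr : 0 < r) :
    fracKer p r = ENNReal.ofReal (truncKer p ε r) + singKer p ε r := by
  rcases le_total ε r with h | h
  · rw [singKer_of_le hp hε h, truncKer_of_le h, add_zero, fracKer]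
  · rw [truncKer, max_eq_right h, singKer, fracKer, ← ENNReal.ofReal_add, add_sub_cancel]
    · positivity
    · exact sub_nonneg.2 (one_div_le_one_div_of_le (Real.rpow_pos_of_pos hr p)
        (Real.rpow_le_rpow hr.le h hp))

theorem singKer_le_nearKer (hp : 0 ≤ p) (hε : 0 < ε) : singKer p ε r ≤ nearKer p ε r := by
  rcases lt_or_ge r ε with h | h
  · rw [nearKer, Set.indicator_of_mem (by exact h)]
    refine ENNReal.ofReal_le_ofReal (sub_le_self _ ?_)
    positivity
  · rw [singKer_of_le hp hε h]
    exact zero_le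

theorem nearKer_le_fracKer : nearKer p ε r ≤ fracKer p r :=
  Set.indicator_le_self _ _ _

/-- Contracting distances by at most a factor `l` multiplies the kernel by at most `l ^ p`. -/
theorem one_div_rpow_le_mul {l r' : ℝ} (hp : 0 ≤ p) (hl : 0 < l) (hr : 0 < r) (hr' : r ≤ l * r') :
    1 / r' ^ p ≤ l ^ p * (1 / r ^ p) := by
  have h0 : 0 < r' := pos_of_mul_pos_right (hr.trans_le hr') hl.le
  rw [mul_one_div, div_le_div_iff₀ (Real.rpow_pos_of_pos h0 p) (Real.rpow_pos_of_pos hr p),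
    one_mul, ← Real.mul_rpow hl.le h0.le]
  exact Real.rpow_le_rpow hr.le hr' hp

theorem nearKer_comp_le {l r' : ℝ} (hp : 0 ≤ p) (hl : 0 < l) (hr : 0 < r)
    (hr' : r ≤ l * r') (hl2 : l ≤ 2) :
    nearKer p ε r' ≤ ENNReal.ofReal (l ^ p) * nearKer p (2 * ε) r := by
  rcases lt_or_ge r' ε with h | h
  · rw [nearKer, nearKer, Set.indicator_of_mem (by exact h), Set.indicator_of_mem, fracKer, fracKer,
      ← ENNReal.ofReal_mul (by positivity)]
    · exact ENNReal.ofReal_le_ofReal (one_div_rpow_le_mul hp hl hr hr')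
    · exact hr'.trans_lt (mul_lt_mul' hl2 h (pos_of_mul_pos_right (hr.trans_le hr') hl.le).le
        (by norm_num))
  · rw [nearKer, Set.indicator_of_notMem (by simpa using h)]
    exact zero_le

theorem singKer_comp_le {l r' : ℝ} (hp : 0 ≤ p) (hl : 1 ≤ l) (hr : 0 < r)
    (hr' : r ≤ l * r') (hl2 : l ≤ 2) (hε : 0 < ε) :
    singKer p ε r' ≤ singKer p ε r + ENNReal.ofReal (l ^ p - 1) * nearKer p (2 * ε) r := by
  have hl0 : 0 < l := by linarith
  have h0 : 0 < r' := pos_of_mul_pos_right (hr.trans_le hr') hl0.le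
  rcases lt_or_ge r' ε with h | h
  · rw [nearKer, Set.indicator_of_mem, fracKer, singKer, singKer, ← ENNReal.ofReal_mul]
    · rw [← sub_nonneg] at hl
      refine le_trans (ENNReal.ofReal_le_ofReal ?_) ENNReal.ofReal_add_le
      have := one_div_rpow_le_mul hp hl0 hr hr'
      linarith
    · exact sub_nonneg.2 (Real.one_le_rpow hl hp)
    · exact hr'.trans_lt (mul_lt_mul' hl2 h h0.le (by norm_num))
  · rw [singKer_of_le hp hε h]
    exact zero_le

end Profiles

/-! ### The singular part along a flow. -/

section SingularPart

variable {n : ℕ} {L : ℝ} {T : ℝ → Euc n → Euc n} {p ε t : ℝ} {U V : Set (Euc n)}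

theorem norm_sub_pos_of_disjoint {x y : Euc n} (hUV : Disjoint U V) (hy : y ∈ U) (hx : x ∈ V) :
    0 < ‖x - y‖ :=
  norm_sub_pos_iff.2 fun h => Set.disjoint_left.1 hUV hy (h ▸ hx)

theorem exp_toNNReal_pow (a : ℝ) (m : ℕ) :
    (((Real.exp a).toNNReal : ENNReal)) ^ m = ENNReal.ofReal (Real.exp (m * a)) := by
  rw [Real.exp_nat_mul, ENNReal.ofReal_pow (Real.exp_pos _).le]
  rfl

theorem exp_le_two {a : ℝ} (h : a ≤ 1 / 2) : Real.exp a ≤ 2 := by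
  have h1 : Real.exp a ^ 2 ≤ 2 ^ 2 := by
    rw [← Real.exp_nat_mul]
    refine (Real.exp_le_exp.2 (show ((2 : ℕ) : ℝ) * a ≤ 1 by push_cast; linarith)).trans ?_
    linarith [Real.exp_one_lt_d9]
  exact (sq_le_sq₀ (Real.exp_pos _).le (by norm_num)).1 h1

theorem interaction_nearKer_image_le (hT : LipschitzFlow L T) (hp : 0 ≤ p)
    (ht : L * |t| ≤ 1 / 2) (hU : MeasurableSet U) (hV : MeasurableSet V) (hUV : Disjoint U V) :
    interaction (nearKer p ε) (T t '' U) (T t '' V) ≤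
      ENNReal.ofReal (Real.exp ((2 * n + p) * (L * |t|))) *
        interaction (nearKer p (2 * ε)) U V := by
  set a := L * |t|
  refine (interaction_image_le (hT.lipschitzWith t) (hT.lipschitzWith (-t)).continuous
    (hT.right_inv t) (hT.left_inv t) hU hV (measurable_nearKer p ε)
    (k' := fun r => ENNReal.ofReal (Real.exp a ^ p) * nearKer p (2 * ε) r) ?_).trans ?_
  · intro y hy x hx
    exact nearKer_comp_le hp (Real.exp_pos _) (norm_sub_pos_of_disjoint hUV hy hx)
      (hT.antilip t x y) (exp_le_two ht)
  · rw [interaction_const_mul ENNReal.ofReal_ne_top, ← mul_assoc, exp_toNNReal_pow,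
      ← ENNReal.ofReal_mul (Real.exp_pos _).le, ← Real.exp_mul, ← Real.exp_add]
    apply le_of_eq
    congr 3
    push_cast
    ring

/-- There are two sources of growth: volumes contribute `exp (2 * n * a)`, and contraction of
distances multiplies the kernel by at most `exp a ^ p`. The second excess acts only at distances
below `2 * ε`, since distances shrink by a factor of at most `2`. -/
theorem interaction_singKer_image_le (hT : LipschitzFlow L T) (hp : 0 ≤ p) (hε : 0 < ε)
    (ht : L * |t| ≤ 1 / 2) (hU : MeasurableSet U) (hV : MeasurableSet V) (hUV : Disjoint U V) :
    interaction (singKer p ε) (T t '' U) (T t '' V) ≤ interaction (singKer p ε) U V +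
      ENNReal.ofReal (Real.exp ((2 * n + p) * (L * |t|)) - 1) *
        interaction (nearKer p (2 * ε)) U V := by
  set a := L * |t|
  have ha : 0 ≤ a := mul_nonneg hT.nonneg (abs_nonneg t)
  have h1a : 1 ≤ Real.exp a := Real.one_le_exp ha
  have hN : interaction (singKer p ε) U V ≤ interaction (nearKer p (2 * ε)) U V :=
    interaction_mono hU hV fun y _ x _ => (singKer_le_nearKer hp hε).trans
      (Set.indicator_le_indicator_of_subset (Set.Iio_subset_Iio (by linarith)) (fun _ => zero_le) _)
  set N := interaction (nearKer p (2 * ε)) U V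
  set g := interaction (singKer p ε) U V
  have h2 : (0 : ℝ) ≤ Real.exp (2 * n * a) - 1 := sub_nonneg.2 (Real.one_le_exp (by positivity))
  have h3 : (0 : ℝ) ≤ Real.exp a ^ p - 1 := sub_nonneg.2 (Real.one_le_rpow h1a hp)
  calc interaction (singKer p ε) (T t '' U) (T t '' V)
      ≤ ENNReal.ofReal (Real.exp (2 * n * a)) * (g + ENNReal.ofReal (Real.exp a ^ p - 1) * N) := by
        refine (interaction_image_le (hT.lipschitzWith t) (hT.lipschitzWith (-t)).continuous
          (hT.right_inv t) (hT.left_inv t) hU hV (measurable_singKer p ε)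
          (k' := fun r => singKer p ε r + ENNReal.ofReal (Real.exp a ^ p - 1) *
            nearKer p (2 * ε) r) ?_).trans ?_
        · intro y hy x hx
          exact singKer_comp_le hp h1a (norm_sub_pos_of_disjoint hUV hy hx)
            (hT.antilip t x y) (exp_le_two ht) hε
        · rw [interaction_add (measurable_singKer p ε), interaction_const_mul ENNReal.ofReal_ne_top,
            exp_toNNReal_pow]
          push_cast
          rfl
    _ = g + ENNReal.ofReal (Real.exp (2 * n * a) - 1) * g +
          ENNReal.ofReal (Real.exp (2 * n * a)) * (ENNReal.ofReal (Real.exp a ^ p - 1) * N) := by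
        have : ENNReal.ofReal (Real.exp (2 * n * a)) =
            1 + ENNReal.ofReal (Real.exp (2 * n * a) - 1) := by
          rw [← ENNReal.ofReal_one, ← ENNReal.ofReal_add (by norm_num) h2, add_sub_cancel]
        rw [mul_add]
        congr 1
        rw [this, add_mul, one_mul]
    _ ≤ g + ENNReal.ofReal (Real.exp (2 * n * a) - 1) * N +
          ENNReal.ofReal (Real.exp (2 * n * a)) * (ENNReal.ofReal (Real.exp a ^ p - 1) * N) := by
        gcongr
    _ = _ := by
        rw [add_assoc, ← mul_assoc (ENNReal.ofReal (Real.exp (2 * n * a))), ← add_mul, ← ENNReal.ofReal_mul (Real.exp_pos _).le,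
          ← ENNReal.ofReal_add h2 (mul_nonneg (Real.exp_pos _).le h3), ← Real.exp_mul]
        congr 3
        rw [mul_sub, ← Real.exp_add]
        ring_nf

/-- The singular part of an interaction changes along the flow at a rate that is controlled by the
interaction at short distances. -/
theorem abs_interaction_singKer_sub_le (hT : LipschitzFlow L T) (hp : 0 ≤ p) (hε : 0 < ε)
    (ht : L * |t| ≤ 1 / 2) (ht' : (2 * n + p) * (L * |t|) ≤ 1) (hU : MeasurableSet U)
    (hV : MeasurableSet V) (hUV : Disjoint U V) (hfin : interaction (fracKer p) U V ≠ ⊤) :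
    interaction (singKer p ε) (T t '' U) (T t '' V) ≠ ⊤ ∧
    |(interaction (singKer p ε) (T t '' U) (T t '' V)).toReal -
        (interaction (singKer p ε) U V).toReal| ≤
      6 * ((2 * n + p) * (L * |t|)) * (interaction (nearKer p (4 * ε)) U V).toReal := by
  have ha : 0 ≤ L * |t| := mul_nonneg hT.nonneg (abs_nonneg t)
  set b := (2 * n + p) * (L * |t|) with hb
  have hb0 : 0 ≤ b := by positivity
  have hfinN : ∀ ε', interaction (nearKer p ε') U V ≠ ⊤ := fun ε' =>
    ne_top_of_le_ne_top hfin (interaction_mono hU hV fun y _ x _ => nearKer_le_fracKer)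
  have hfing : interaction (singKer p ε) U V ≠ ⊤ :=
    ne_top_of_le_ne_top (hfinN ε) (interaction_mono hU hV fun y _ x _ => singKer_le_nearKer hp hε)
  have hmono : interaction (nearKer p (2 * ε)) U V ≤ interaction (nearKer p (4 * ε)) U V :=
    interaction_mono hU hV fun y _ x _ =>
      Set.indicator_le_indicator_of_subset (Set.Iio_subset_Iio (by linarith)) (fun _ => zero_le) _
  have hUV' : Disjoint (T t '' U) (T t '' V) :=
    (Set.disjoint_image_iff (Function.LeftInverse.injective (hT.left_inv t))).2 hUV
  have h1 := interaction_singKer_image_le hT hp hε ht hU hV hUV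
  -- The reverse inequality comes from flowing back. Its error lives on the moved sets at distances
  -- below `2 * ε`, and moving it to the original sets widens the range once more, to `4 * ε`.
  have h2 := interaction_singKer_image_le (t := -t) hT hp hε (by simpa using ht)
    (hT.measurableSet_image t hU) (hT.measurableSet_image t hV) hUV'
  have h3 := interaction_nearKer_image_le (t := t) hT hp (ε := 2 * ε) ht hU hV hUV
  rw [hT.image_image, hT.image_image, abs_neg, ← hb] at h2
  rw [← hb] at h1 h3
  rw [show 2 * (2 * ε) = 4 * ε by ring] at h3
  set N := interaction (nearKer p (4 * ε)) U V
  set g := interaction (singKer p ε) U V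
  set g' := interaction (singKer p ε) (T t '' U) (T t '' V)
  have hN : N ≠ ⊤ := hfinN _
  have he : Real.exp b - 1 ≤ 2 * b := by
    have := Real.abs_exp_sub_one_le (x := b) (by rwa [abs_of_nonneg hb0])
    rw [abs_of_nonneg hb0] at this
    exact (le_abs_self _).trans this
  have he1 : 1 ≤ Real.exp b := Real.one_le_exp hb0
  have h1' : g' ≤ g + ENNReal.ofReal (6 * b) * N := by
    refine h1.trans ?_
    gcongr
    linarith
  have h2' : g ≤ g' + ENNReal.ofReal (6 * b) * N := by
    refine h2.trans (add_le_add le_rfl ?_)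
    refine (mul_le_mul' le_rfl h3).trans ?_
    rw [← mul_assoc, ← ENNReal.ofReal_mul (by linarith)]
    refine mul_le_mul' (ENNReal.ofReal_le_ofReal ?_) le_rfl
    calc (Real.exp b - 1) * Real.exp b ≤ (2 * b) * 3 := by gcongr; linarith
      _ = 6 * b := by ring
  have hg' : g' ≠ ⊤ := ne_top_of_le_ne_top (ENNReal.add_ne_top.2
    ⟨hfing, ENNReal.mul_ne_top ENNReal.ofReal_ne_top hN⟩) h1'
  have hm : (ENNReal.ofReal (6 * b) * N).toReal = 6 * b * N.toReal := by
    rw [ENNReal.toReal_mul, ENNReal.toReal_ofReal (by positivity)]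
  refine ⟨hg', abs_sub_le_iff.2 ⟨?_, ?_⟩⟩
  · have := ENNReal.toReal_mono (ENNReal.add_ne_top.2
      ⟨hfing, ENNReal.mul_ne_top ENNReal.ofReal_ne_top hN⟩) h1'
    rw [ENNReal.toReal_add hfing (ENNReal.mul_ne_top ENNReal.ofReal_ne_top hN), hm] at this
    linarith
  · have := ENNReal.toReal_mono (ENNReal.add_ne_top.2
      ⟨hg', ENNReal.mul_ne_top ENNReal.ofReal_ne_top hN⟩) h2'
    rw [ENNReal.toReal_add hg' (ENNReal.mul_ne_top ENNReal.ofReal_ne_top hN), hm] at this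
    linarith

theorem interaction_eq_lintegral_prod {k : ℝ → ENNReal} (hk : Measurable k) (U V : Set (Euc n)) :
    interaction k U V =
      ∫⁻ q, k ‖q.2 - q.1‖ ∂((volume.restrict U).prod (volume.restrict V)) :=
  (lintegral_prod _ (measurable_kernel hk).aemeasurable).symm

/-- Dominated convergence with the full kernel as the bound; finiteness of the full interaction is
what makes the singular part negligible. -/
theorem tendsto_interaction_nearKer (hp : 0 < p) (hfin : interaction (fracKer p) U V ≠ ⊤) :
    Filter.Tendsto (fun ε => (interaction (nearKer p ε) U V).toReal) (𝓝[>] 0) (𝓝 0) := by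
  suffices h : Filter.Tendsto (fun ε => interaction (nearKer p ε) U V) (𝓝[>] 0) (𝓝 0) by
    simpa [Function.comp_def] using (ENNReal.tendsto_toReal ENNReal.zero_ne_top).comp h
  simp_rw [interaction_eq_lintegral_prod (measurable_nearKer p _)]
  rw [interaction_eq_lintegral_prod (measurable_fracKer p)] at hfin
  suffices h : Filter.Tendsto (fun ε => ∫⁻ q, nearKer p ε ‖q.2 - q.1‖
      ∂((volume.restrict U).prod (volume.restrict V))) (𝓝[>] 0)
      (𝓝 (∫⁻ _, 0 ∂((volume.restrict U).prod (volume.restrict V)))) by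
    simpa only [lintegral_zero] using h
  refine tendsto_lintegral_filter_of_dominated_convergence _
    (Filter.Eventually.of_forall fun ε => measurable_kernel (measurable_nearKer p ε))
    (Filter.Eventually.of_forall fun ε => Filter.Eventually.of_forall fun q => nearKer_le_fracKer)
    hfin (Filter.Eventually.of_forall fun q => ?_)
  rcases (norm_nonneg (q.2 - q.1)).eq_or_lt with h | h
  · rw [← h]
    -- On the diagonal the default `1 / 0 = 0` makes the kernel vanish, so no null-set argument is
    -- needed.
    have : ∀ ε, nearKer p ε 0 = 0 := fun ε => by
      refine le_antisymm (nearKer_le_fracKer.trans ?_) zero_le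
      simp [fracKer, Real.zero_rpow hp.ne']
    simp [this]
  · refine tendsto_const_nhds.congr' ?_
    filter_upwards [Ioo_mem_nhdsGT h] with ε hε
    rw [nearKer, Set.indicator_of_notMem]
    simpa using hε.2.le

end SingularPart

/-! ### Finiteness of the fractional perimeter of balls. -/

section FinitePerimeter

variable {n : ℕ}

theorem smul_image_ball_compl {d : ℝ} (hd : 0 < d) :
    (fun x : Euc n => d • x) '' (ball 0 1)ᶜ = (ball 0 d)ᶜ := by
  ext x
  simp only [Set.mem_image, Set.mem_compl_iff, mem_ball_zero_iff, not_lt]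
  constructor
  · rintro ⟨y, hy, rfl⟩
    rw [norm_smul, Real.norm_of_nonneg hd.le]
    nlinarith
  · intro hx
    refine ⟨d⁻¹ • x, ?_, smul_inv_smul₀ hd.ne' x⟩
    rw [norm_smul, Real.norm_of_nonneg (by positivity), inv_mul_eq_div, le_div_iff₀ hd]
    linarith

theorem lintegral_fracKer_ball_one_compl_ne_top {p : ℝ} (hp : (n : ℝ) < p) :
    ∫⁻ z in (ball (0 : Euc n) 1)ᶜ, fracKer p ‖z‖ ≠ ⊤ := by
  have hp0 : 0 < p := (Nat.cast_nonneg n).trans_lt hp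
  have hi : Integrable (fun x : Euc n => 2 ^ p * (1 + ‖x‖) ^ (-p)) :=
    (integrable_one_add_norm (by simpa using hp)).const_mul _
  refine ne_top_of_le_ne_top hi.lintegral_lt_top.ne
    ((setLIntegral_mono' measurableSet_ball.compl fun z hz => ?_).trans
      (setLIntegral_le_lintegral _ _))
  have hz1 : 1 ≤ ‖z‖ := by simpa using hz
  refine ENNReal.ofReal_le_ofReal ?_
  rw [Real.rpow_neg (by positivity), ← one_div]
  exact one_div_rpow_le_mul hp0.le (by norm_num) (by positivity) (by linarith)

/-- Translate to the origin and rescale to the unit ball: the volume factor `d ^ n` and the kernel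
factor `d ^ (-(n + s))` combine to `d ^ (-s)`. -/
theorem lintegral_fracKer_compl_ball_le {s d : ℝ} (hd : 0 < d) (y : Euc n) :
    ∫⁻ x in (ball y d)ᶜ, fracKer (n + s) ‖x - y‖ ≤
      ENNReal.ofReal (d ^ (-s)) * ∫⁻ z in (ball (0 : Euc n) 1)ᶜ, fracKer (n + s) ‖z‖ := by
  have h1 : ∫⁻ x in (ball y d)ᶜ, fracKer (n + s) ‖x - y‖ =
      ∫⁻ z in (ball (0 : Euc n) d)ᶜ, fracKer (n + s) ‖z‖ := by
    rw [← lintegral_indicator measurableSet_ball.compl,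
      ← lintegral_indicator measurableSet_ball.compl]
    refine Eq.trans ?_ (lintegral_sub_right_eq_self
      ((ball (0 : Euc n) d)ᶜ.indicator fun z => fracKer (n + s) ‖z‖) y)
    refine lintegral_congr fun x => ?_
    have hx : x ∈ (ball y d)ᶜ ↔ x - y ∈ (ball (0 : Euc n) d)ᶜ := by simp [dist_eq_norm]
    by_cases hm : x ∈ (ball y d)ᶜ
    · rw [Set.indicator_of_mem hm, Set.indicator_of_mem (hx.1 hm)]
    · rw [Set.indicator_of_notMem hm, Set.indicator_of_notMem fun h => hm (hx.2 h)]
  have hl : LipschitzWith d.toNNReal fun x : Euc n => d • x :=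
    LipschitzWith.of_dist_le_mul fun x y => by
      rw [dist_smul₀, Real.norm_of_nonneg hd.le, Real.coe_toNNReal _ hd.le]
  rw [h1, ← smul_image_ball_compl hd]
  refine (lintegral_image_le hl (continuous_const_smul d⁻¹) (smul_inv_smul₀ hd.ne')
    (inv_smul_smul₀ hd.ne') measurableSet_ball.compl
    ((measurable_fracKer _).comp measurable_norm)).trans ?_
  have h2 : ∀ z : Euc n, fracKer (n + s) ‖d • z‖ =
      ENNReal.ofReal (d ^ (-(n + s))) * fracKer (n + s) ‖z‖ := fun z => by
    rw [fracKer, fracKer, ← ENNReal.ofReal_mul (by positivity), norm_smul,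
      Real.norm_of_nonneg hd.le, Real.mul_rpow hd.le (norm_nonneg z), Real.rpow_neg hd.le]
    congr 1
    rw [one_div, one_div, mul_inv]
  simp only [Function.comp_apply, h2]
  rw [lintegral_const_mul' _ _ ENNReal.ofReal_ne_top, ← mul_assoc,
    show ((d.toNNReal : ENNReal)) = ENNReal.ofReal d from rfl, ← ENNReal.ofReal_pow hd.le,
    ← ENNReal.ofReal_mul (by positivity), ← Real.rpow_natCast, ← Real.rpow_add hd]
  apply le_of_eq
  congr 3
  ring

theorem integrableOn_sub_norm_rpow [Nontrivial (Euc n)] {s r : ℝ} (hs : s < 1) :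
    IntegrableOn (fun y : Euc n => (r - ‖y‖) ^ (-s)) (ball 0 r) := by
  refine (integrableOn_fun_norm_addHaar volume (f := fun y => (r - y) ^ (-s))).2 ?_
  rcases le_or_gt r 0 with hr | hr
  · simp [Set.Ioo_eq_empty (not_lt.2 hr)]
  have h1 : IntervalIntegrable (fun y : ℝ => (r - y) ^ (-s)) volume 0 r := by
    have := (intervalIntegral.intervalIntegrable_rpow' (a := r) (b := 0)
      (r := -s) (by linarith)).comp_sub_left r
    simpa using this
  have h2 : IntegrableOn (fun y : ℝ => (r - y) ^ (-s)) (Set.Ioo 0 r) :=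
    ((intervalIntegrable_iff_integrableOn_Ioc_of_le hr.le).1 h1).mono_set Set.Ioo_subset_Ioc_self
  refine Integrable.mono' (h2.const_mul (r ^ (Module.finrank ℝ (Euc n) - 1)))
    (by fun_prop) ?_
  refine (ae_restrict_iff' measurableSet_Ioo).2 (Filter.Eventually.of_forall fun y hy => ?_)
  have h3 : 0 ≤ (r - y) ^ (-s) := Real.rpow_nonneg (by linarith [hy.2]) _
  rw [norm_smul, Real.norm_of_nonneg h3, norm_pow, Real.norm_of_nonneg hy.1.le]
  gcongr
  · exact hy.1.le
  · exact hy.2.le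

/-- Balls have finite fractional perimeter. -/
theorem interaction_fracKer_ball_compl_ne_top [Nontrivial (Euc n)] {s : ℝ} (hs : 0 < s)
    (hs1 : s < 1) (r : ℝ) :
    interaction (fracKer (n + s)) (ball (0 : Euc n) r) (ball 0 r)ᶜ ≠ ⊤ := by
  set C := ∫⁻ z in (ball (0 : Euc n) 1)ᶜ, fracKer (n + s) ‖z‖
  have hC : C ≠ ⊤ := lintegral_fracKer_ball_one_compl_ne_top (by linarith)
  -- The ball around `y` of radius `r - ‖y‖` lies inside, so the inner integral is at most a tail of
  -- size `(r - ‖y‖) ^ (-s)`, which is integrable because `s < 1`.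
  have h : interaction (fracKer (n + s)) (ball (0 : Euc n) r) (ball 0 r)ᶜ ≤
      ∫⁻ y in ball (0 : Euc n) r, ENNReal.ofReal ((r - ‖y‖) ^ (-s)) * C := by
    refine setLIntegral_mono' measurableSet_ball fun y hy => ?_
    have hy' : 0 < r - ‖y‖ := by simpa using hy
    refine (lintegral_mono_set (Set.compl_subset_compl.2 fun x hx => ?_)).trans
      (lintegral_fracKer_compl_ball_le hy' y)
    rw [mem_ball, dist_eq_norm] at hx
    rw [mem_ball_zero_iff]
    linarith [norm_sub_norm_le x y]
  refine ne_top_of_le_ne_top ?_ h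
  rw [lintegral_mul_const' _ _ hC]
  exact ENNReal.mul_ne_top (integrableOn_sub_norm_rpow hs1).lintegral_lt_top.ne hC

end FinitePerimeter

/-! ### Potentials and energies of the truncated kernel. -/

/-- The potential of a set with respect to the truncated kernel. -/
def pot {n : ℕ} (p ε : ℝ) (V : Set (Euc n)) (y : Euc n) : ℝ := ∫ x in V, truncKer p ε ‖x - y‖

/-- The total mass of the truncated kernel. -/
def truncMass (n : ℕ) (p ε : ℝ) : ℝ := ∫ x : Euc n, truncKer p ε ‖x‖

/-- The interaction of two sets through the truncated kernel, as a real number. -/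
def energy {n : ℕ} (p ε : ℝ) (U V : Set (Euc n)) : ℝ := ∫ y in U, pot p ε V y

section Potential

variable {n : ℕ} {p ε : ℝ} {U V W : Set (Euc n)}

theorem truncKer_nonneg (hε : 0 < ε) (r : ℝ) : 0 ≤ truncKer p ε r := by
  have : 0 < max r ε := hε.trans_le (le_max_right _ _)
  unfold truncKer; positivity

theorem truncKer_le (hp : 0 ≤ p) (hε : 0 < ε) (r : ℝ) : truncKer p ε r ≤ 1 / ε ^ p :=
  one_div_le_one_div_of_le (Real.rpow_pos_of_pos hε p)
    (Real.rpow_le_rpow hε.le (le_max_right _ _) hp)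

theorem abs_truncKer_le (hp : 0 ≤ p) (hε : 0 < ε) (r : ℝ) : ‖truncKer p ε r‖ ≤ 1 / ε ^ p := by
  rw [Real.norm_of_nonneg (truncKer_nonneg hε r)]
  exact truncKer_le hp hε r

theorem continuous_truncKer (hε : 0 < ε) : Continuous (truncKer p ε) := by
  have h : ∀ r, max r ε ≠ 0 := fun r => (hε.trans_le (le_max_right r ε)).ne'
  refine continuous_const.div ?_ fun r =>
    (Real.rpow_pos_of_pos (hε.trans_le (le_max_right r ε)) p).ne'
  exact (continuous_id.max continuous_const).rpow_const fun r => Or.inl (h r)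

theorem integrable_truncKer (hp : (n : ℝ) < p) (hε : 0 < ε) (y : Euc n) :
    Integrable fun x : Euc n => truncKer p ε ‖x - y‖ := by
  have hp0 : 0 < p := (Nat.cast_nonneg n).trans_lt hp
  suffices h : Integrable fun x : Euc n => truncKer p ε ‖x‖ from h.comp_sub_right y
  refine Integrable.mono' ((integrable_one_add_norm (by simpa using hp)).const_mul
    ((1 + 1 / ε) ^ p)) ((continuous_truncKer hε).comp continuous_norm).aestronglyMeasurable
    (Filter.Eventually.of_forall fun x => ?_)
  rw [Real.norm_of_nonneg (truncKer_nonneg hε _), Real.rpow_neg (by positivity), ← one_div]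
  refine one_div_rpow_le_mul hp0.le (by positivity) (by positivity) ?_
  rw [add_mul, one_mul, add_comm]
  refine add_le_add (le_max_left _ _) ?_
  rw [one_div, inv_mul_eq_div, le_div_iff₀ hε, one_mul]
  exact le_max_right _ _

theorem pot_nonneg (hε : 0 < ε) (V : Set (Euc n)) (y : Euc n) : 0 ≤ pot p ε V y :=
  integral_nonneg fun _ => truncKer_nonneg hε _

theorem pot_univ (y : Euc n) : pot p ε Set.univ y = truncMass n p ε := by
  unfold pot
  rw [Measure.restrict_univ]
  exact integral_sub_right_eq_self (fun x : Euc n => truncKer p ε ‖x‖) y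

theorem pot_le_univ (hp : (n : ℝ) < p) (hε : 0 < ε) (V : Set (Euc n)) (y : Euc n) :
    pot p ε V y ≤ truncMass n p ε := by
  rw [← pot_univ y]
  exact setIntegral_mono_set (integrable_truncKer hp hε y).integrableOn
    (Filter.Eventually.of_forall fun x => truncKer_nonneg hε _)
    (Set.subset_univ V).eventuallyLE

theorem pot_compl (hp : (n : ℝ) < p) (hε : 0 < ε) (hV : MeasurableSet V) (y : Euc n) :
    pot p ε Vᶜ y = truncMass n p ε - pot p ε V y := by
  rw [← pot_univ y]
  unfold pot
  rw [Measure.restrict_univ, ← integral_add_compl hV (integrable_truncKer hp hε y)]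
  ring

theorem pot_diff (hp : (n : ℝ) < p) (hε : 0 < ε) (hV : MeasurableSet V) (hVW : V ⊆ W)
    (y : Euc n) : pot p ε (W \ V) y = pot p ε W y - pot p ε V y :=
  setIntegral_sdiff hV (integrable_truncKer hp hε y).integrableOn hVW

theorem measurable_pot (V : Set (Euc n)) : Measurable (pot p ε V) := by
  have h : StronglyMeasurable fun q : Euc n × Euc n => truncKer p ε ‖q.2 - q.1‖ := by
    have := measurable_truncKer p ε
    exact Measurable.stronglyMeasurable (by fun_prop)
  exact (h.integral_prod_right' (ν := volume.restrict V)).measurable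

theorem integrableOn_pot (hp : (n : ℝ) < p) (hε : 0 < ε) (hU : volume U ≠ ⊤) (V : Set (Euc n)) :
    IntegrableOn (pot p ε V) U := by
  refine Measure.integrableOn_of_bounded (M := truncMass n p ε) hU
    (measurable_pot V).aestronglyMeasurable (Filter.Eventually.of_forall fun y => ?_)
  rw [Real.norm_of_nonneg (pot_nonneg hε V y)]
  exact pot_le_univ hp hε V y

theorem interaction_truncKer (hp : (n : ℝ) < p) (hε : 0 < ε) (hU : volume U ≠ ⊤)
    (V : Set (Euc n)) :
    interaction (fun r => ENNReal.ofReal (truncKer p ε r)) U V =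
      ENNReal.ofReal (energy p ε U V) := by
  rw [energy, ofReal_integral_eq_lintegral_ofReal (integrableOn_pot hp hε hU V)
    (Filter.Eventually.of_forall fun y => pot_nonneg hε V y)]
  refine lintegral_congr fun y => ?_
  rw [pot, ofReal_integral_eq_lintegral_ofReal (integrable_truncKer hp hε y).integrableOn
    (Filter.Eventually.of_forall fun x => truncKer_nonneg hε _)]

theorem energy_nonneg (hε : 0 < ε) (U V : Set (Euc n)) : 0 ≤ energy p ε U V :=
  integral_nonneg fun y => pot_nonneg hε V y

theorem energy_comm (hp : (n : ℝ) < p) (hε : 0 < ε) (hU : volume U ≠ ⊤) (hV : volume V ≠ ⊤) :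
    energy p ε U V = energy p ε V U := by
  rw [← ENNReal.toReal_ofReal (energy_nonneg hε U V), ← interaction_truncKer hp hε hU,
    interaction_comm (measurable_truncKer p ε).ennreal_ofReal, interaction_truncKer hp hε hV,
    ENNReal.toReal_ofReal (energy_nonneg hε V U)]

theorem energy_compl_right (hp : (n : ℝ) < p) (hε : 0 < ε) (hU : volume U ≠ ⊤)
    (hV : MeasurableSet V) :
    energy p ε U Vᶜ = truncMass n p ε * volume.real U - energy p ε U V := by
  unfold energy
  simp_rw [pot_compl hp hε hV]
  rw [integral_sub (f := fun _ => truncMass n p ε) (μ := volume.restrict U)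
    (integrableOn_const hU) (integrableOn_pot hp hε hU V), setIntegral_const, smul_eq_mul, mul_comm]

theorem energy_diff_right (hp : (n : ℝ) < p) (hε : 0 < ε) (hU : volume U ≠ ⊤)
    (hV : MeasurableSet V) (hVW : V ⊆ W) :
    energy p ε U (W \ V) = energy p ε U W - energy p ε U V := by
  unfold energy
  simp_rw [pot_diff hp hε hV hVW]
  rw [integral_sub (integrableOn_pot hp hε hU W) (integrableOn_pot hp hε hU V)]

theorem energy_diff_left (hp : (n : ℝ) < p) (hε : 0 < ε) (hW : volume W ≠ ⊤)
    (hV : MeasurableSet V) (hVW : V ⊆ W) (U : Set (Euc n)) :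
    energy p ε (W \ V) U = energy p ε W U - energy p ε V U :=
  setIntegral_sdiff hV (integrableOn_pot hp hε hW U) hVW

theorem continuous_pot (hp : (n : ℝ) < p) (hε : 0 < ε) (hV : volume V ≠ ⊤) :
    Continuous (pot p ε V) := by
  have hp0 : 0 < p := (Nat.cast_nonneg n).trans_lt hp
  refine continuous_of_dominated (bound := fun _ => 1 / ε ^ p)
    (fun y => (integrable_truncKer hp hε y).aestronglyMeasurable.restrict)
    (fun y => Filter.Eventually.of_forall fun x => abs_truncKer_le hp0.le hε _)
    (integrableOn_const hV) (Filter.Eventually.of_forall fun x => ?_)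
  exact (continuous_truncKer hε).comp (by fun_prop)

/-- The reflection exchanging `y` and `y'` preserves volume and centred balls. This symmetry is what
lets the first variation see only volume changes. -/
theorem pot_ball_eq_of_norm_eq {r : ℝ} {y y' : Euc n} (h : ‖y‖ = ‖y'‖) :
    pot p ε (ball 0 r) y = pot p ε (ball 0 r) y' := by
  set R := (ℝ ∙ (y - y'))ᗮ.reflection with hR
  have hRy : R y = y' := Submodule.reflection_sub h
  have hpre : R ⁻¹' (ball (0 : Euc n) r) = ball 0 r := by
    ext x
    simp
  unfold pot
  rw [← R.measurePreserving.setIntegral_preimage_emb R.toHomeomorph.measurableEmbedding _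
    (ball 0 r), hpre]
  refine integral_congr_ae (Filter.Eventually.of_forall fun x => ?_)
  simp only
  have hRR : R (R x) = x := Submodule.reflection_reflection _ x
  rw [← hRy, ← R.norm_map (R x - y), map_sub, hRR]

theorem pot_congr_ker {ε' : ℝ} (hV : MeasurableSet V) {y : Euc n}
    (h : ∀ x ∈ V, ε ≤ ‖x - y‖ ∧ ε' ≤ ‖x - y‖) : pot p ε V y = pot p ε' V y :=
  setIntegral_congr_fun hV fun x hx => by
    rw [truncKer_of_le (h x hx).1, truncKer_of_le (h x hx).2]

theorem abs_setIntegral_sub_le {f : Euc n → ℝ} {c : ℝ} (hU : MeasurableSet U)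
    (hV : MeasurableSet V) (hUf : volume U ≠ ⊤) (hVf : volume V ≠ ⊤)
    (hfU : IntegrableOn f U) (hfV : IntegrableOn f V) (hc : ∀ x ∈ symmDiff U V, ‖f x‖ ≤ c) :
    |(∫ x in U, f x) - ∫ x in V, f x| ≤ c * volume.real (symmDiff U V) := by
  have h1 := integral_inter_add_sdiff hV hfU
  have h2 := integral_inter_add_sdiff hU hfV
  rw [Set.inter_comm] at h2
  have hd1 : volume (U \ V) < ⊤ := (measure_mono Set.sdiff_subset).trans_lt hUf.lt_top
  have hd2 : volume (V \ U) < ⊤ := (measure_mono Set.sdiff_subset).trans_lt hVf.lt_top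
  have h3 := norm_setIntegral_le_of_norm_le_const (f := f) hd1 fun x hx => hc x (Or.inl hx)
  have h4 := norm_setIntegral_le_of_norm_le_const (f := f) hd2 fun x hx => hc x (Or.inr hx)
  have h5 : volume.real (symmDiff U V) = volume.real (U \ V) + volume.real (V \ U) := by
    rw [measureReal_def, measure_symmDiff_eq hU.nullMeasurableSet hV.nullMeasurableSet,
      ENNReal.toReal_add hd1.ne hd2.ne]
    rfl
  rw [← h1, ← h2, h5, mul_add, add_sub_add_left_eq_sub]
  exact (abs_sub _ _).trans (add_le_add h3 h4)

theorem abs_pot_sub_le (hp : (n : ℝ) < p) (hε : 0 < ε) (hU : MeasurableSet U)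
    (hV : MeasurableSet V) (hUf : volume U ≠ ⊤) (hVf : volume V ≠ ⊤) (y : Euc n) :
    |pot p ε U y - pot p ε V y| ≤ 1 / ε ^ p * volume.real (symmDiff U V) :=
  abs_setIntegral_sub_le hU hV hUf hVf (integrable_truncKer hp hε y).integrableOn
    (integrable_truncKer hp hε y).integrableOn fun _ _ =>
      abs_truncKer_le ((Nat.cast_nonneg n).trans hp.le) hε _

end Potential

/-! ### First variation of truncated energies of moving balls. -/

section Shell

theorem eventually_mul_abs_lt (c : ℝ) {b : ℝ} (hb : 0 < b) : ∀ᶠ t in 𝓝 (0 : ℝ), c * |t| < b := by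
  have h : Continuous fun t : ℝ => c * |t| := by fun_prop
  exact (h.tendsto' 0 0 (by simp)).eventually_lt_const hb

theorem eventually_abs_lt {b : ℝ} (hb : 0 < b) : ∀ᶠ t in 𝓝 (0 : ℝ), |t| < b := by
  simpa using eventually_mul_abs_lt 1 hb

variable {n : ℕ} {L : ℝ} {T : ℝ → Euc n → Euc n} {p ε r : ℝ}

theorem volume_real_ball [Nontrivial (Euc n)] (hr : 0 ≤ r) :
    volume.real (ball (0 : Euc n) r) = r ^ n * volume.real (ball (0 : Euc n) 1) := by
  rw [measureReal_def, Measure.addHaar_ball _ _ hr, ENNReal.toReal_mul,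
    ENNReal.toReal_ofReal (by positivity), finrank_euclideanSpace_fin]
  rfl

namespace LipschitzFlow

theorem volume_image_ne_top (hT : LipschitzFlow L T) (t r : ℝ) :
    volume (T t '' ball 0 r) ≠ ⊤ :=
  ne_top_of_le_ne_top (ENNReal.mul_ne_top (by simp) measure_ball_lt_top.ne)
    (volume_image_le (hT.lipschitzWith t) _)

/-- The symmetric difference lies in a shell of half-width `L * (1 + r) * |t|` around the sphere,
whose volume is linear in that width. -/
theorem exists_volume_symmDiff_le [Nontrivial (Euc n)] (hT : LipschitzFlow L T) (hr : 0 < r) :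
    ∃ C, 0 ≤ C ∧ ∀ᶠ t in 𝓝 (0 : ℝ),
      volume.real (symmDiff (T t '' ball 0 r) (ball 0 r)) ≤ C * |t| := by
  have hL := hT.nonneg
  set w := volume.real (ball (0 : Euc n) 1)
  set c := L * (1 + r)
  refine ⟨2 * c * n * (2 * r) ^ (n - 1) * w, by positivity, ?_⟩
  have h1 : ∀ᶠ t in 𝓝 (0 : ℝ), |t| < 1 := eventually_abs_lt one_pos
  have h2 := eventually_mul_abs_lt c hr
  filter_upwards [h1, h2] with t ht ht2
  set d := c * |t|
  have hd : 0 ≤ d := by positivity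
  have hsub : symmDiff (T t '' ball 0 r) (ball 0 r) ⊆
      closedBall (0 : Euc n) (r + d) \ ball 0 (r - d) := fun x hx => by
    have := abs_le.1 (hT.mem_shell ht.le hx)
    simp only [Set.mem_sdiff, mem_closedBall_zero_iff, mem_ball_zero_iff, not_lt]
    constructor <;> linarith [this.1, this.2]
  calc volume.real (symmDiff (T t '' ball 0 r) (ball 0 r))
      ≤ volume.real (closedBall (0 : Euc n) (r + d) \ ball 0 (r - d)) :=
        measureReal_mono hsub (ne_top_of_le_ne_top measure_closedBall_lt_top.ne
          (measure_mono Set.sdiff_subset))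
    _ = ((r + d) ^ n - (r - d) ^ n) * w := by
        rw [measureReal_sdiff (fun x hx => ball_subset_closedBall
          (ball_subset_ball (by linarith) hx)) measurableSet_ball
          measure_closedBall_lt_top.ne,
          Measure.addHaar_real_closedBall _ _ (by linarith),
          volume_real_ball (r := r - d) (by linarith), finrank_euclideanSpace_fin, sub_mul]
    _ ≤ (2 * d * n * (2 * r) ^ (n - 1)) * w := by
        gcongr
        refine (le_abs_self _).trans ((abs_pow_sub_pow_le _ _ _).trans ?_)
        rw [show r + d - (r - d) = 2 * d by ring, abs_of_nonneg (by positivity : 0 ≤ 2 * d)]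
        gcongr
        rw [abs_of_nonneg (by linarith), abs_of_nonneg (by linarith)]
        exact max_le (by linarith) (by linarith)
    _ = _ := by ring

/-- The integral over a moving ball changes to first order like the volume, with the value of the
integrand on the sphere as the factor. -/
theorem setIntegral_sub_isLittleO [Nontrivial (Euc n)] (hT : LipschitzFlow L T) (hr : 0 < r) {φ : ℝ → Euc n → ℝ} {h : ℝ}
    (hint : ∀ t t', IntegrableOn (φ t) (T t' '' ball 0 r))
    (hint' : ∀ t, IntegrableOn (φ t) (ball 0 r))
    (hφ : ∀ η > 0, ∃ δ > 0, ∀ x, |‖x‖ - r| < δ → |φ 0 x - h| ≤ η)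
    (hunif : ∀ η > 0, ∀ᶠ t in 𝓝 (0 : ℝ), ∀ x, |φ t x - φ 0 x| ≤ η) :
    (fun t => (∫ x in T t '' ball 0 r, φ t x) - (∫ x in ball 0 r, φ t x) -
      h * (volume.real (T t '' ball 0 r) - volume.real (ball (0 : Euc n) r)))
      =o[𝓝 0] fun t : ℝ => t := by
  obtain ⟨C, hC0, hC⟩ := hT.exists_volume_symmDiff_le hr
  rw [Asymptotics.isLittleO_iff]
  intro c hc
  set η := c / (2 * (C + 1)) with hη
  have hη0 : 0 < η := by positivity
  obtain ⟨δ, hδ, hφδ⟩ := hφ η hη0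
  have hL := hT.nonneg
  have h1 : ∀ᶠ t in 𝓝 (0 : ℝ), |t| < 1 := eventually_abs_lt one_pos
  have h2 := eventually_mul_abs_lt (L * (1 + r)) hδ
  filter_upwards [h1, h2, hC, hunif η hη0] with t ht ht2 htC htu
  have hAm := hT.measurableSet_image t (measurableSet_ball (x := (0 : Euc n)) (ε := r))
  have hAf := hT.volume_image_ne_top t r
  have hBf : volume (ball (0 : Euc n) r) ≠ ⊤ := measure_ball_lt_top.ne
  -- Subtracting the constant `h` removes the volume term. What remains is at most `2 * η` on the
  -- symmetric difference: one `η` for closeness to the sphere and one for the time dependence of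
  -- `φ`.
  have key := abs_setIntegral_sub_le (f := fun x => φ t x - h) (c := 2 * η) hAm measurableSet_ball
    hAf hBf ((hint t t).sub (integrableOn_const hAf)) ((hint' t).sub (integrableOn_const hBf))
    fun x hx => by
      have := hφδ x ((hT.mem_shell ht.le hx).trans_lt ht2)
      have h3 := abs_add_le (φ t x - φ 0 x) (φ 0 x - h)
      rw [sub_add_sub_cancel] at h3
      rw [Real.norm_eq_abs]
      linarith [htu x]
  rw [integral_sub (hint t t) (integrableOn_const hAf),
    integral_sub (hint' t) (integrableOn_const hBf), setIntegral_const, setIntegral_const] at key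
  simp only [smul_eq_mul] at key
  rw [Real.norm_eq_abs, Real.norm_eq_abs]
  calc _ = |(∫ x in T t '' ball 0 r, φ t x) - volume.real (T t '' ball 0 r) * h -
          ((∫ x in ball 0 r, φ t x) - volume.real (ball (0 : Euc n) r) * h)| := by
        congr 1; ring
    _ ≤ 2 * η * (C * |t|) := key.trans (by gcongr)
    _ = c * (C / (C + 1)) * |t| := by rw [hη]; field_simp
    _ ≤ c * 1 * |t| := by
        gcongr
        rw [div_le_one (by positivity)]
        linarith
    _ = c * |t| := by ring

end LipschitzFlow

theorem exists_near_sphere_pot_ball (hp : (n : ℝ) < p) (hε : 0 < ε) (r R : ℝ) {e : Euc n}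
    (he : ‖e‖ = 1) :
    ∀ η > 0, ∃ δ > 0, ∀ x : Euc n, |‖x‖ - r| < δ →
      |pot p ε (ball 0 R) x - pot p ε (ball 0 R) (r • e)| ≤ η := by
  intro η hη
  have hc : Continuous fun ρ : ℝ => pot p ε (ball 0 R) (ρ • e) :=
    (continuous_pot hp hε measure_ball_lt_top.ne).comp (continuous_id.smul continuous_const)
  obtain ⟨δ, hδ, h⟩ := Metric.continuousAt_iff.1 (hc.continuousAt (x := r)) η hη
  refine ⟨δ, hδ, fun x hx => ?_⟩
  have := h (x := ‖x‖) (by rwa [Real.dist_eq])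
  rw [Real.dist_eq, pot_ball_eq_of_norm_eq (y' := x) (by simp [norm_smul, he])] at this
  exact this.le

namespace LipschitzFlow

theorem eventually_abs_pot_sub_le [Nontrivial (Euc n)] (hT : LipschitzFlow L T) (hp : (n : ℝ) < p) (hε : 0 < ε)
    {R : ℝ} (hR : 0 < R) :
    ∀ η > 0, ∀ᶠ t in 𝓝 (0 : ℝ), ∀ x : Euc n,
      |pot p ε (T t '' ball 0 R) x - pot p ε (ball 0 R) x| ≤ η := by
  intro η hη
  obtain ⟨C, hC0, hC⟩ := hT.exists_volume_symmDiff_le hR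
  have h2 := eventually_mul_abs_lt (1 / ε ^ p * C) hη
  filter_upwards [hC, h2] with t htC ht2 x
  refine (abs_pot_sub_le hp hε (hT.measurableSet_image t measurableSet_ball) measurableSet_ball
    (hT.volume_image_ne_top t R) measure_ball_lt_top.ne x).trans (le_trans ?_ ht2.le)
  rw [mul_assoc]
  gcongr

theorem image_zero (hT : LipschitzFlow L T) (U : Set (Euc n)) : T 0 '' U = U := by
  have : ∀ x, T 0 x = x := fun x => by
    have := hT.disp 0 x (by simp)
    simpa [sub_eq_zero] using this
  simp [this]

/-- First variation of the truncated energy of a fixed ball and a moving ball. -/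
theorem energy_fixed_sub_isLittleO [Nontrivial (Euc n)] (hT : LipschitzFlow L T) (hp : (n : ℝ) < p) (hε : 0 < ε)
    (hr : 0 < r) (R : ℝ) {e : Euc n} (he : ‖e‖ = 1) :
    (fun t => energy p ε (T t '' ball 0 r) (ball 0 R) - energy p ε (ball (0 : Euc n) r) (ball 0 R) -
      pot p ε (ball 0 R) (r • e) *
        (volume.real (T t '' ball 0 r) - volume.real (ball (0 : Euc n) r)))
      =o[𝓝 0] fun t : ℝ => t :=
  hT.setIntegral_sub_isLittleO hr (φ := fun _ => pot p ε (ball 0 R))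
    (fun _ t => integrableOn_pot hp hε (hT.volume_image_ne_top t r) _)
    (fun _ => integrableOn_pot hp hε measure_ball_lt_top.ne _)
    (exists_near_sphere_pot_ball hp hε r R he) (fun η hη => by simp [hη.le])

/-- First variation of the truncated energy of two moving balls. -/
theorem energy_sub_isLittleO [Nontrivial (Euc n)] (hT : LipschitzFlow L T) (hp : (n : ℝ) < p) (hε : 0 < ε)
    (hr : 0 < r) {R : ℝ} (hR : 0 < R) {e : Euc n} (he : ‖e‖ = 1) :
    (fun t => energy p ε (T t '' ball 0 r) (T t '' ball 0 R) -
        energy p ε (ball (0 : Euc n) r) (ball 0 R) -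
        (pot p ε (ball 0 R) (r • e) *
          (volume.real (T t '' ball 0 r) - volume.real (ball (0 : Euc n) r)) +
        pot p ε (ball 0 r) (R • e) *
          (volume.real (T t '' ball 0 R) - volume.real (ball (0 : Euc n) R))))
      =o[𝓝 0] fun t : ℝ => t := by
  have h1 := hT.setIntegral_sub_isLittleO hr (φ := fun t => pot p ε (T t '' ball 0 R))
    (h := pot p ε (ball 0 R) (r • e))
    (fun _ t => integrableOn_pot hp hε (hT.volume_image_ne_top t r) _)
    (fun _ => integrableOn_pot hp hε measure_ball_lt_top.ne _)
    (by simpa only [hT.image_zero] using exists_near_sphere_pot_ball hp hε r R he)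
    (by simpa only [hT.image_zero] using hT.eventually_abs_pot_sub_le hp hε hR)
  -- Move one ball at a time: `h1` varies the ball of radius `r` against the already moved ball, and
  -- `h2` varies the ball of radius `R` against the fixed one. Symmetry of the energy makes the sum
  -- telescope.
  have h2 := hT.energy_fixed_sub_isLittleO hp hε hR r he
  refine (h1.add h2).congr_left fun t => ?_
  have hb : ∀ ρ, volume (ball (0 : Euc n) ρ) ≠ ⊤ := fun ρ => measure_ball_lt_top.ne
  have e1 : energy p ε (T t '' ball 0 R) (ball 0 r) = energy p ε (ball (0 : Euc n) r) (T t '' ball 0 R) :=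
    energy_comm hp hε (hT.volume_image_ne_top t R) (hb r)
  have e2 : energy p ε (ball (0 : Euc n) R) (ball 0 r) = energy p ε (ball (0 : Euc n) r) (ball 0 R) :=
    energy_comm hp hε (hb R) (hb r)
  rw [e1, e2]
  unfold energy
  ring

end LipschitzFlow

end Shell

/-! ### Homogeneity under dilations. -/

section Scaling

variable {n : ℕ} {p ε : ℝ}

theorem one_div_mul_rpow {c r : ℝ} (hc : 0 ≤ c) (hr : 0 ≤ r) :
    1 / (c * r) ^ p = c ^ (-p) * (1 / r ^ p) := by
  rw [Real.mul_rpow hc hr, Real.rpow_neg hc, one_div, one_div, mul_inv]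

theorem interaction_smul_le {s c : ℝ} (hc : 0 < c) {U V : Set (Euc n)} (hU : MeasurableSet U)
    (hV : MeasurableSet V) :
    interaction (fracKer (n + s)) ((fun x => c • x) '' U) ((fun x => c • x) '' V) ≤
      ENNReal.ofReal (c ^ (n - s)) * interaction (fracKer (n + s)) U V := by
  have hl : LipschitzWith c.toNNReal fun x : Euc n => c • x :=
    LipschitzWith.of_dist_le_mul fun x y => by
      rw [dist_smul₀, Real.norm_of_nonneg hc.le, Real.coe_toNNReal _ hc.le]
  refine (interaction_image_le hl (continuous_const_smul c⁻¹) (smul_inv_smul₀ hc.ne')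
    (inv_smul_smul₀ hc.ne') hU hV (measurable_fracKer _)
    (k' := fun r => ENNReal.ofReal (c ^ (-(n + s))) * fracKer (n + s) r) ?_).trans ?_
  · intro y _ x _
    rw [fracKer, fracKer, ← smul_sub, norm_smul, Real.norm_of_nonneg hc.le,
      one_div_mul_rpow hc.le (norm_nonneg _), ENNReal.ofReal_mul (by positivity)]
  · rw [interaction_const_mul ENNReal.ofReal_ne_top, ← mul_assoc,
      show ((c.toNNReal : ENNReal)) = ENNReal.ofReal c from rfl, ← ENNReal.ofReal_pow hc.le,
      ← ENNReal.ofReal_mul (by positivity), ← Real.rpow_natCast, ← Real.rpow_add hc]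
    apply le_of_eq
    congr 3
    push_cast
    ring

theorem interaction_smul {s c : ℝ} (hc : 0 < c) {U V : Set (Euc n)} (hU : MeasurableSet U)
    (hV : MeasurableSet V) :
    interaction (fracKer (n + s)) ((fun x => c • x) '' U) ((fun x => c • x) '' V) =
      ENNReal.ofReal (c ^ (n - s)) * interaction (fracKer (n + s)) U V := by
  refine le_antisymm (interaction_smul_le hc hU hV) ?_
  have hm : ∀ W : Set (Euc n), MeasurableSet W → MeasurableSet ((fun x => c • x) '' W) :=
    fun W hW => (Homeomorph.smulOfNeZero c hc.ne').measurableEmbedding.measurableSet_image.2 hW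
  have hi : ∀ W : Set (Euc n), (fun x => c⁻¹ • x) '' ((fun x => c • x) '' W) = W := fun W => by
    simp [Set.image_image, inv_smul_smul₀ hc.ne']
  have h := interaction_smul_le (s := s) (inv_pos.2 hc) (hm U hU) (hm V hV)
  rw [hi, hi] at h
  refine (mul_le_mul' le_rfl h).trans ?_
  rw [← mul_assoc, ← ENNReal.ofReal_mul (by positivity), Real.inv_rpow hc.le,
    mul_inv_cancel₀ (Real.rpow_pos_of_pos hc _).ne', ENNReal.ofReal_one, one_mul]

open Pointwise in
theorem pot_smul {c : ℝ} (hc : 0 < c) (V : Set (Euc n)) (y : Euc n) :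
    pot p (c * ε) (c • V) (c • y) = c ^ (n - p) * pot p ε V y := by
  have h := Measure.setIntegral_comp_smul_of_pos volume
    (fun x : Euc n => truncKer p (c * ε) ‖x - c • y‖) V hc
  have h1 : ∀ x : Euc n, truncKer p (c * ε) ‖c • x - c • y‖ = c ^ (-p) * truncKer p ε ‖x - y‖ := by
    intro x
    rw [← smul_sub, norm_smul, Real.norm_of_nonneg hc.le, truncKer,
      ← mul_max_of_nonneg _ _ hc.le,
      one_div_mul_rpow hc.le ((norm_nonneg _).trans (le_max_left _ _)), truncKer]
  simp_rw [h1] at h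
  rw [integral_const_mul, finrank_euclideanSpace_fin, smul_eq_mul, inv_mul_eq_div,
    eq_div_iff (by positivity)] at h
  rw [pot, ← h, sub_eq_add_neg, Real.rpow_add hc, Real.rpow_natCast, pot]
  ring

theorem pot_ball_smul {c : ℝ} (hc : 0 < c) (r : ℝ) (y : Euc n) :
    pot p (c * ε) (ball 0 (c * r)) (c • y) = c ^ (n - p) * pot p ε (ball 0 r) y := by
  rw [← pot_smul hc, _root_.smul_ball hc.ne', smul_zero, Real.norm_of_nonneg hc.le]

theorem truncMass_smul {c : ℝ} (hc : 0 < c) :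
    truncMass n p (c * ε) = c ^ (n - p) * truncMass n p ε := by
  rw [← pot_univ (0 : Euc n), ← pot_univ (0 : Euc n), ← pot_smul hc, smul_zero,
    Set.smul_set_univ₀ hc.ne']

end Scaling

/-! ### The curvature of the unit ball. -/

section BallCurvature

theorem tendsto_const_mul_nhdsGT_zero {c : ℝ} (hc : 0 < c) :
    Filter.Tendsto (fun ε : ℝ => c * ε) (𝓝[>] 0) (𝓝[>] 0) := by
  refine tendsto_nhdsWithin_iff.2 ⟨?_, ?_⟩
  · have : Continuous fun ε : ℝ => c * ε := by fun_prop
    exact (this.tendsto' 0 0 (by simp)).mono_left nhdsWithin_le_nhds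
  · filter_upwards [self_mem_nhdsWithin] with ε hε
    exact mul_pos hc hε

variable {n : ℕ} {L : ℝ} {T : ℝ → Euc n → Euc n} {p ε r : ℝ}

theorem interaction_fracKer_eq_add (hp : 0 ≤ p) (hε : 0 < ε) {U V : Set (Euc n)}
    (hU : MeasurableSet U) (hV : MeasurableSet V) (hUV : Disjoint U V) :
    interaction (fracKer p) U V = interaction (fun r => ENNReal.ofReal (truncKer p ε r)) U V +
      interaction (singKer p ε) U V := by
  rw [← interaction_add (measurable_truncKer p ε).ennreal_ofReal]
  exact interaction_congr hU hV fun y hy x hx =>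
    fracKer_eq_add hp hε (norm_sub_pos_of_disjoint hUV hy hx)

theorem interaction_fracKer_eq_energy_add (hp : (n : ℝ) < p) (hε : 0 < ε) {U V : Set (Euc n)}
    (hU : MeasurableSet U) (hV : MeasurableSet V) (hUf : volume U ≠ ⊤) (hUV : Disjoint U V) :
    interaction (fracKer p) U V = ENNReal.ofReal (energy p ε U V) +
      interaction (singKer p ε) U V := by
  rw [interaction_fracKer_eq_add ((Nat.cast_nonneg n).trans hp.le) hε hU hV hUV,
    interaction_truncKer hp hε hUf]

/-- The mean curvature of the ball of radius `r` with respect to the truncated kernel; here `e` is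
any unit vector. -/
def truncCurvature (p ε r : ℝ) (e : Euc n) : ℝ :=
  truncMass n p ε - 2 * pot p ε (ball 0 r) (r • e)

/-- The truncated perimeter of a set is mass times volume minus self-energy, so its first variation
is `truncCurvature` times the change of volume. The term with `nearKer` is the cost of the singular
part. -/
theorem LipschitzFlow.abs_perimeter_sub_le [Nontrivial (Euc n)] (hT : LipschitzFlow L T)
    (hp : (n : ℝ) < p) (hε : 0 < ε) (hr : 0 < r) {e : Euc n} (he : ‖e‖ = 1)
    (hfin : interaction (fracKer p) (ball (0 : Euc n) r) (ball 0 r)ᶜ ≠ ⊤) {η : ℝ} (hη : 0 < η) :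
    ∀ᶠ t in 𝓝 (0 : ℝ),
      |(interaction (fracKer p) (T t '' ball 0 r) (T t '' ball 0 r)ᶜ).toReal -
        (interaction (fracKer p) (ball (0 : Euc n) r) (ball 0 r)ᶜ).toReal -
        truncCurvature p ε r e *
          (volume.real (T t '' ball 0 r) - volume.real (ball (0 : Euc n) r))| ≤
      (6 * ((2 * n + p) * L) *
        (interaction (nearKer p (4 * ε)) (ball (0 : Euc n) r) (ball 0 r)ᶜ).toReal + η) * |t| := by
  have hp0 : 0 ≤ p := (Nat.cast_nonneg n).trans hp.le
  have h1 := hT.energy_sub_isLittleO hp hε hr hr he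
  filter_upwards [Asymptotics.isLittleO_iff.1 h1 hη,
    eventually_mul_abs_lt L (show (0 : ℝ) < 1 / 2 by norm_num),
    eventually_mul_abs_lt ((2 * n + p) * L) one_pos] with t ht1 ht2 ht3
  rw [mul_assoc] at ht3
  have hA := measurableSet_ball (x := (0 : Euc n)) (ε := r)
  have hAt := hT.measurableSet_image t hA
  obtain ⟨hg', hg⟩ := abs_interaction_singKer_sub_le hT hp0 hε ht2.le ht3.le hA hA.compl
    disjoint_compl_right hfin
  rw [hT.image_compl] at hg hg'
  have hg0 : interaction (singKer p ε) (ball (0 : Euc n) r) (ball 0 r)ᶜ ≠ ⊤ := by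
    rw [interaction_fracKer_eq_add hp0 hε hA hA.compl disjoint_compl_right] at hfin
    exact (ENNReal.add_ne_top.1 hfin).2
  rw [interaction_fracKer_eq_energy_add hp hε hA hA.compl measure_ball_lt_top.ne
      disjoint_compl_right,
    interaction_fracKer_eq_energy_add hp hε hAt hAt.compl (hT.volume_image_ne_top t r)
      disjoint_compl_right, ENNReal.toReal_add ENNReal.ofReal_ne_top hg',
    ENNReal.toReal_add ENNReal.ofReal_ne_top hg0, ENNReal.toReal_ofReal (energy_nonneg hε _ _),
    ENNReal.toReal_ofReal (energy_nonneg hε _ _),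
    energy_compl_right hp hε (hT.volume_image_ne_top t r) hAt,
    energy_compl_right hp hε measure_ball_lt_top.ne hA, truncCurvature]
  rw [Real.norm_eq_abs, Real.norm_eq_abs] at ht1
  rw [abs_le] at ht1 hg ⊢
  constructor <;> nlinarith [ht1.1, ht1.2, hg.1, hg.2]

/-- The fractional mean curvature of the unit ball, defined by the rate of change of the perimeter
under dilation. -/
def ballCurvature (n : ℕ) (s : ℝ) : ℝ :=
  (n - s) * (interaction (fracKer (n + s)) (ball (0 : Euc n) 1) (ball 0 1)ᶜ).toReal /
    (n * volume.real (ball (0 : Euc n) 1))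

theorem exp_smul_image_ball (t : ℝ) :
    (fun x : Euc n => Real.exp t • x) '' ball 0 1 = ball 0 (Real.exp t) := by
  have h := _root_.smul_ball (Real.exp_pos t).ne' (0 : Euc n) 1
  rw [smul_zero, Real.norm_of_nonneg (Real.exp_pos t).le, mul_one] at h
  exact h

theorem volume_real_ball_one_pos : 0 < volume.real (ball (0 : Euc n) 1) :=
  ENNReal.toReal_pos (measure_ball_pos volume _ one_pos).ne' measure_ball_lt_top.ne

/-- For the dilation flow, perimeter and volume are exactly `exp (t * (n - s))` and `exp (t * n)`
times their initial values. Comparing their derivatives at `0` with the perimeter estimate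
identifies the curvature up to the singular error. -/
theorem abs_truncCurvature_sub_le [Nontrivial (Euc n)] {s : ℝ} (hn : 1 ≤ n) (hs : 0 < s)
    (hs1 : s < 1) (hε : 0 < ε) {e : Euc n} (he : ‖e‖ = 1) :
    |ballCurvature n s - truncCurvature (n + s) ε 1 e| * (n * volume.real (ball (0 : Euc n) 1)) ≤
      6 * ((2 * n + (n + s)) * 2) * (interaction (nearKer (n + s) (4 * ε))
        (ball (0 : Euc n) 1) (ball 0 1)ᶜ).toReal := by
  have hfin := interaction_fracKer_ball_compl_ne_top (n := n) hs hs1 1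
  set N := (interaction (nearKer (n + s) (4 * ε)) (ball (0 : Euc n) 1) (ball 0 1)ᶜ).toReal
  set P := (interaction (fracKer (n + s)) (ball (0 : Euc n) 1) (ball 0 1)ᶜ).toReal with hP
  set w := volume.real (ball (0 : Euc n) 1)
  have hw : 0 < w := volume_real_ball_one_pos
  have hn0 : (0 : ℝ) < n := by exact_mod_cast hn
  set H := truncCurvature (n + s) ε 1 e
  refine le_of_forall_pos_le_add fun η hη => ?_
  have hev := (lipschitzFlow_exp_smul n).abs_perimeter_sub_le (p := n + s) (by linarith) hε one_pos
    he hfin hη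
  have hd : HasDerivAt (fun t : ℝ => Real.exp (t * (n - s)) * P - P -
      H * (Real.exp (t * n) * w - w)) ((n - s) * P - H * (n * w)) 0 := by
    have h1 : ∀ a : ℝ, HasDerivAt (fun t : ℝ => Real.exp (t * a)) a 0 := fun a => by
      simpa using ((hasDerivAt_id (0 : ℝ)).mul_const a).exp
    exact (((h1 (n - s)).mul_const P).sub_const P).sub
      ((((h1 n).mul_const w).sub_const w).const_mul H)
  -- The function vanishes at `0` and is bounded by a multiple of `|t|`, so the same constant bounds
  -- its derivative there.
  have hle := hd.le_of_lip' (C := 6 * ((2 * n + (n + s)) * 2) * N + η) (by positivity) ?_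
  · rw [Real.norm_eq_abs] at hle
    refine le_trans (le_of_eq ?_) hle
    rw [← abs_of_pos (mul_pos hn0 hw), ← abs_mul, abs_of_pos (mul_pos hn0 hw), ballCurvature,
      sub_mul, div_mul_cancel₀ _ (mul_pos hn0 hw).ne']
  · filter_upwards [hev] with t ht
    have e1 : volume.real (ball (0 : Euc n) (Real.exp t)) = Real.exp (t * n) * w := by
      rw [volume_real_ball (Real.exp_pos t).le, ← Real.exp_nat_mul, mul_comm t]
    have e2 : (interaction (fracKer (n + s)) (ball (0 : Euc n) (Real.exp t))
        (ball 0 (Real.exp t))ᶜ).toReal = Real.exp (t * (n - s)) * P := by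
      have := interaction_smul (s := s) (Real.exp_pos t) (measurableSet_ball (x := (0 : Euc n))
        (ε := 1)) (measurableSet_ball (x := (0 : Euc n)) (ε := 1)).compl
      rw [exp_smul_image_ball, smul_image_ball_compl (Real.exp_pos t)] at this
      rw [this, ENNReal.toReal_mul, ENNReal.toReal_ofReal (by positivity), ← Real.exp_mul]
    rw [exp_smul_image_ball, e1, e2] at ht
    simpa using ht

theorem tendsto_truncCurvature [Nontrivial (Euc n)] {s : ℝ} (hn : 1 ≤ n) (hs : 0 < s)
    (hs1 : s < 1) {e : Euc n} (he : ‖e‖ = 1) :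
    Filter.Tendsto (fun ε => truncCurvature (n + s) ε 1 e) (𝓝[>] 0) (𝓝 (ballCurvature n s)) := by
  have hn0 : (0 : ℝ) < n := by exact_mod_cast hn
  have hw : 0 < n * volume.real (ball (0 : Euc n) 1) := mul_pos hn0 volume_real_ball_one_pos
  have h4 : Filter.Tendsto (fun ε : ℝ => 4 * ε) (𝓝[>] 0) (𝓝[>] 0) :=
    tendsto_const_mul_nhdsGT_zero four_pos
  have h := ((tendsto_interaction_nearKer (U := ball (0 : Euc n) 1) (V := (ball 0 1)ᶜ)
    (show (0 : ℝ) < n + s by linarith) (interaction_fracKer_ball_compl_ne_top hs hs1 1)).comp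
    h4).const_mul (6 * ((2 * n + (n + s)) * 2) / (n * volume.real (ball (0 : Euc n) 1)))
  rw [mul_zero] at h
  rw [tendsto_iff_dist_tendsto_zero]
  refine squeeze_zero' (Filter.Eventually.of_forall fun _ => dist_nonneg) ?_ h
  filter_upwards [self_mem_nhdsWithin] with ε hε
  rw [dist_comm, Real.dist_eq, Function.comp_apply, div_mul_eq_mul_div, le_div_iff₀ hw]
  exact abs_truncCurvature_sub_le hn hs hs1 hε he

theorem le_pot (hp : (n : ℝ) < p) (hε : 0 < ε) {V : Set (Euc n)} {y z : Euc n} {d m : ℝ}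
    (hV : ball z d ⊆ V) (hm : ∀ x ∈ ball z d, ‖x - y‖ ≤ m) (hεm : ε ≤ m) :
    1 / m ^ p * volume.real (ball z d) ≤ pot p ε V y := by
  have hp0 : 0 ≤ p := (Nat.cast_nonneg n).trans hp.le
  have hi := integrable_truncKer hp hε y
  calc 1 / m ^ p * volume.real (ball z d) = ∫ x in ball z d, 1 / m ^ p := by
        rw [setIntegral_const, smul_eq_mul, mul_comm]
    _ ≤ ∫ x in ball z d, truncKer p ε ‖x - y‖ := by
        refine setIntegral_mono_on (integrableOn_const measure_ball_lt_top.ne) hi.integrableOn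
          measurableSet_ball fun x hx => ?_
        exact one_div_le_one_div_of_le (Real.rpow_pos_of_pos (hε.trans_le (le_max_right _ _)) p)
          (Real.rpow_le_rpow (hε.le.trans (le_max_right _ _)) (max_le (hm x hx) hεm) hp0)
    _ ≤ pot p ε V y := setIntegral_mono_set hi.integrableOn
        (Filter.Eventually.of_forall fun x => truncKer_nonneg hε _) hV.eventuallyLE

theorem ballCurvature_pos [Nontrivial (Euc n)] {s : ℝ} (hn : 1 ≤ n) (hs : 0 < s) (hs1 : s < 1)
    {e : Euc n} (he : ‖e‖ = 1) : 0 < ballCurvature n s := by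
  have hn1 : (1 : ℝ) ≤ n := by exact_mod_cast hn
  have hw : 0 < volume.real (ball (0 : Euc n) 1) := volume_real_ball_one_pos
  refine div_pos (mul_pos (by linarith) (ENNReal.toReal_pos ?_
    (interaction_fracKer_ball_compl_ne_top hs hs1 1))) (mul_pos (by linarith) hw)
  have hA := measurableSet_ball (x := (0 : Euc n)) (ε := 1)
  have hAf : volume (ball (0 : Euc n) 1) ≠ ⊤ := measure_ball_lt_top.ne
  have hp : (n : ℝ) < n + s := by linarith
  rw [interaction_fracKer_eq_energy_add hp one_pos hA hA.compl hAf disjoint_compl_right]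
  -- The unit ball centred at `3 • e` avoids the unit ball at the origin, and points of the two are
  -- at distance at most `5`.
  set c := 1 / 5 ^ (n + s) * volume.real (ball ((3 : ℝ) • e) 1) with hc
  have hc0 : 0 < c := mul_pos (by positivity)
    (ENNReal.toReal_pos (measure_ball_pos volume _ one_pos).ne' measure_ball_lt_top.ne)
  have h3e : ‖(3 : ℝ) • e‖ = 3 := by simp [norm_smul, he]
  have h3 : ∀ y ∈ ball (0 : Euc n) 1, c ≤ pot (n + s) 1 (ball (0 : Euc n) 1)ᶜ y := by
    intro y hy
    rw [mem_ball_zero_iff] at hy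
    refine le_pot hp one_pos (fun x hx => ?_) (fun x hx => ?_) (by norm_num)
    · rw [mem_ball, dist_eq_norm, norm_sub_rev] at hx
      have := norm_sub_norm_le ((3 : ℝ) • e) x
      simp only [Set.mem_compl_iff, mem_ball_zero_iff, not_lt]
      linarith
    · rw [mem_ball, dist_eq_norm] at hx
      have h1 := norm_sub_norm_le x ((3 : ℝ) • e)
      have h2 := norm_sub_le x y
      linarith
  have h4 : c * volume.real (ball (0 : Euc n) 1) ≤ energy (n + s) 1 (ball (0 : Euc n) 1)
      (ball 0 1)ᶜ := by
    have := setIntegral_mono_on (integrableOn_const hAf) (integrableOn_pot hp one_pos hAf _) hA h3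
    rwa [setIntegral_const, smul_eq_mul, mul_comm] at this
  intro h0
  rw [add_eq_zero, ENNReal.ofReal_eq_zero] at h0
  exact absurd ((mul_pos hc0 hw).trans_le (h4.trans h0.1)) (lt_irrefl _)

end BallCurvature

/-! ### Existence of the critical radii. -/

section Radii

variable {n : ℕ} {p ε s : ℝ}

/-- Dominated convergence: the indicators converge off the sphere of radius `τ`, which is a null
set. This continuity feeds the intermediate value arguments. -/
theorem continuous_pot_ball_radius [Nontrivial (Euc n)] (hp : (n : ℝ) < p) (hε : 0 < ε) (y : Euc n) :
    Continuous fun τ : ℝ => pot p ε (ball 0 τ) y := by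
  have hi := integrable_truncKer hp hε y
  have h : ∀ τ : ℝ, pot p ε (ball 0 τ) y =
      ∫ x, (ball (0 : Euc n) τ).indicator (fun x => truncKer p ε ‖x - y‖) x := fun τ =>
    (integral_indicator measurableSet_ball).symm
  simp_rw [h]
  refine continuous_iff_continuousAt.2 fun τ => ?_
  refine tendsto_integral_filter_of_dominated_convergence
    (fun x => truncKer p ε ‖x - y‖)
    (Filter.Eventually.of_forall fun σ => (hi.indicator measurableSet_ball).aestronglyMeasurable)
    (Filter.Eventually.of_forall fun σ => Filter.Eventually.of_forall fun x => ?_) hi ?_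
  · refine (norm_indicator_le_norm_self _ _).trans (le_of_eq ?_)
    exact Real.norm_of_nonneg (truncKer_nonneg hε _)
  · have hs : ∀ᵐ x : Euc n, x ∉ sphere (0 : Euc n) τ :=
      measure_eq_zero_iff_ae_notMem.1 (Measure.addHaar_sphere volume 0 τ)
    filter_upwards [hs] with x hx
    rw [mem_sphere_zero_iff_norm] at hx
    refine tendsto_const_nhds.congr' ?_
    rcases lt_or_gt_of_ne hx with h | h
    · filter_upwards [Ioi_mem_nhds h] with σ hσ
      rw [Set.indicator_of_mem (by simpa using h), Set.indicator_of_mem (by simpa using hσ)]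
    · filter_upwards [Iio_mem_nhds h] with σ hσ
      rw [Set.indicator_of_notMem (by simpa using h.le),
        Set.indicator_of_notMem (by simpa using (Set.mem_Iio.1 hσ).le)]

theorem tendsto_pot_ball_atTop (hp : (n : ℝ) < p) (hε : 0 < ε) (y : Euc n) :
    Filter.Tendsto (fun m : ℕ => pot p ε (ball 0 m) y) Filter.atTop (𝓝 (truncMass n p ε)) := by
  rw [← pot_univ y, ← iUnion_ball_nat (0 : Euc n)]
  exact tendsto_setIntegral_of_monotone (fun _ => measurableSet_ball)
    (fun a b h => ball_subset_ball (by exact_mod_cast h))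
    (integrable_truncKer hp hε y).integrableOn

theorem rpow_div_three_mul_rpow {δ : ℝ} (hδ : 0 < δ) :
    1 / (3 * δ) ^ ((n : ℝ) + s) * δ ^ n = 1 / 3 ^ ((n : ℝ) + s) * δ ^ (-s) := by
  rw [mul_comm 3 δ, one_div_mul_rpow hδ.le (by norm_num), ← Real.rpow_natCast, mul_right_comm,
    ← Real.rpow_add hδ, mul_comm]
  congr 2
  ring

theorem volume_real_ball_eq [Nontrivial (Euc n)] (z : Euc n) {d : ℝ} (hd : 0 ≤ d) :
    volume.real (ball z d) = d ^ n * volume.real (ball (0 : Euc n) 1) := by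
  rw [← volume_real_ball hd, measureReal_def, measureReal_def,
    Measure.addHaar_ball_center]

/-- The potential at a point at distance `δ` from a set that contains balls of radius `δ` touching
its boundary near the point blows up as `δ` tends to `0`. -/
theorem tendsto_blowup (n : ℕ) [Nontrivial (Euc n)] (hs : 0 < s) :
    Filter.Tendsto (fun δ : ℝ => 1 / (3 * δ) ^ ((n : ℝ) + s) *
      (δ ^ n * volume.real (ball (0 : Euc n) 1))) (𝓝[>] 0) Filter.atTop := by
  have h := (tendsto_rpow_neg_nhdsGT_zero (neg_lt_zero.2 hs)).const_mul_atTop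
    (show 0 < 1 / 3 ^ ((n : ℝ) + s) * volume.real (ball (0 : Euc n) 1) from
      mul_pos (by positivity) volume_real_ball_one_pos)
  refine h.congr' ?_
  filter_upwards [self_mem_nhdsWithin] with δ hδ
  rw [← mul_assoc (1 / (3 * δ) ^ ((n : ℝ) + s)), rpow_div_three_mul_rpow hδ]
  ring

/-- Balls whose complement has a prescribed potential at a unit vector. -/
theorem exists_radius_compl [Nontrivial (Euc n)] (hs : 0 < s) {e : Euc n} (he : ‖e‖ = 1) {M : ℝ} (hM : 0 < M) :
    ∃ ρ > 1, ∀ᶠ ε in 𝓝[>] (0 : ℝ),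
      truncMass n (n + s) ε - pot (n + s) ε (ball 0 ρ) e = M := by
  have hp : (n : ℝ) < n + s := by linarith
  obtain ⟨δ, hδM, hδ⟩ := (((tendsto_blowup n hs).eventually_ge_atTop M).and
    self_mem_nhdsWithin).exists
  have hδ0 : 0 < δ := hδ
  -- For `τ ≥ 1 + δ` the complement of the ball stays at distance at least `δ` from `e`, so
  -- truncation at `δ` is invisible and the solution found works for every smaller `ε`.
  set f := fun τ : ℝ => truncMass n (n + s) δ - pot (n + s) δ (ball 0 τ) e
  have hf : Continuous f := continuous_const.sub (continuous_pot_ball_radius hp hδ0 e)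
  have hsmall : M ≤ f (1 + δ) := by
    rw [← volume_real_ball_eq ((1 + 2 * δ) • e) hδ0.le] at hδM
    refine hδM.trans ?_
    simp only [f]
    rw [← pot_compl hp hδ0 measurableSet_ball]
    -- The ball of radius `δ` centred at `(1 + 2 * δ) • e` touches the sphere of radius `1 + δ` from
    -- outside and lies within `3 * δ` of `e`.
    refine le_pot hp hδ0 (fun x hx => ?_) (fun x hx => ?_) (by linarith)
    · rw [mem_ball, dist_eq_norm, norm_sub_rev] at hx
      have h1 := norm_sub_norm_le ((1 + 2 * δ) • e) x
      rw [norm_smul, he, Real.norm_of_nonneg (by linarith)] at h1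
      simp only [Set.mem_compl_iff, mem_ball_zero_iff, not_lt]
      linarith
    · rw [mem_ball, dist_eq_norm] at hx
      have h1 : x - e = (x - (1 + 2 * δ) • e) + (2 * δ) • e := by
        rw [add_smul, one_smul]; abel
      have h2 := norm_add_le (x - (1 + 2 * δ) • e) ((2 * δ) • e)
      rw [← h1, norm_smul, he, Real.norm_of_nonneg (by linarith)] at h2
      linarith
  obtain ⟨m, hm, hm1⟩ : ∃ m : ℕ, f m ≤ M ∧ 1 + δ ≤ m := by
    have h1 := (tendsto_pot_ball_atTop hp hδ0 e).const_sub (truncMass n (n + s) δ)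
    rw [sub_self] at h1
    have h2 := tendsto_natCast_atTop_atTop (R := ℝ).eventually_ge_atTop (1 + δ)
    exact ((h1.eventually_le_const hM).and h2).exists
  obtain ⟨ρ, ⟨hρ1, hρ2⟩, hρ⟩ := intermediate_value_Icc' hm1 hf.continuousOn ⟨hm, hsmall⟩
  refine ⟨ρ, by linarith, ?_⟩
  filter_upwards [Ioo_mem_nhdsGT hδ0] with ε hε
  rw [← hρ]
  simp only [f]
  rw [← pot_compl hp hδ0 measurableSet_ball, ← pot_compl hp hε.1 measurableSet_ball]
  refine pot_congr_ker measurableSet_ball.compl fun x hx => ?_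
  have h1 := norm_sub_norm_le x e
  simp only [Set.mem_compl_iff, mem_ball_zero_iff, not_lt] at hx
  constructor <;> linarith [hε.2]

/-- Balls whose potential at an outer point is twice the potential of the unit ball. -/
theorem exists_radius_double [Nontrivial (Euc n)] (hs : 0 < s) {e : Euc n} (he : ‖e‖ = 1) {ρ : ℝ} (hρ : 1 < ρ) :
    ∃ τ, 1 < τ ∧ τ < ρ ∧ ∀ᶠ ε in 𝓝[>] (0 : ℝ),
      pot (n + s) ε (ball 0 τ) (ρ • e) = 2 * pot (n + s) ε (ball 0 1) (ρ • e) := by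
  have hp : (n : ℝ) < n + s := by linarith
  have hρe : ‖ρ • e‖ = ρ := by rw [norm_smul, he, Real.norm_of_nonneg (by linarith), mul_one]
  have hcongr : ∀ τ ε δ : ℝ, ε ≤ ρ - τ → δ ≤ ρ - τ →
      pot (n + s) ε (ball 0 τ) (ρ • e) = pot (n + s) δ (ball 0 τ) (ρ • e) := fun τ ε δ hε hδ => by
    refine pot_congr_ker measurableSet_ball fun x hx => ?_
    rw [mem_ball_zero_iff] at hx
    have h1 := norm_sub_norm_le (ρ • e) x
    rw [norm_sub_rev, hρe] at h1
    constructor <;> linarith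
  set M := pot (n + s) (ρ - 1) (ball 0 1) (ρ • e)
  have hM : 0 < M := by
    refine lt_of_lt_of_le (mul_pos ?_ volume_real_ball_one_pos)
      (le_pot hp (sub_pos.2 hρ) subset_rfl (m := 1 + ρ) (fun x hx => ?_) (by linarith))
    · positivity
    · rw [mem_ball_zero_iff] at hx
      have := norm_sub_le x (ρ • e)
      linarith
  -- Keeping `δ` below `(ρ - 1) / 2` leaves room for `1 < ρ - δ`, and near `ρ - δ` the blow-up
  -- pushes the potential past `2 * M`.
  obtain ⟨δ, ⟨hδM, hδ1⟩, hδ⟩ := ((((tendsto_blowup n hs).eventually_ge_atTop (2 * M)).and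
    (Ioo_mem_nhdsGT (show 0 < (ρ - 1) / 2 by linarith))).and self_mem_nhdsWithin).exists
  have hδ0 : 0 < δ := hδ
  have hδ2 := hδ1.2
  set f := fun τ : ℝ => pot (n + s) δ (ball 0 τ) (ρ • e)
  have hf : Continuous f := continuous_pot_ball_radius hp hδ0 _
  have hf1 : f 1 = M := hcongr 1 δ (ρ - 1) (by linarith) le_rfl
  have hlarge : 2 * M ≤ f (ρ - δ) := by
    rw [← volume_real_ball_eq ((ρ - 2 * δ) • e) hδ0.le] at hδM
    refine hδM.trans (le_pot hp hδ0 (fun x hx => ?_) (fun x hx => ?_) (by linarith))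
    · rw [mem_ball, dist_eq_norm] at hx
      have h1 := norm_sub_norm_le x ((ρ - 2 * δ) • e)
      rw [norm_smul, he, Real.norm_of_nonneg (by linarith)] at h1
      rw [mem_ball_zero_iff]
      linarith
    · rw [mem_ball, dist_eq_norm] at hx
      have h1 : x - ρ • e = (x - (ρ - 2 * δ) • e) - (2 * δ) • e := by
        rw [sub_smul]; abel
      have h2 := norm_sub_le (x - (ρ - 2 * δ) • e) ((2 * δ) • e)
      rw [← h1, norm_smul, he, Real.norm_of_nonneg (by linarith)] at h2
      linarith
  obtain ⟨τ, ⟨hτ1, hτ2⟩, hτ⟩ := intermediate_value_Icc (show 1 ≤ ρ - δ by linarith)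
    hf.continuousOn (show 2 * M ∈ Set.Icc (f 1) (f (ρ - δ)) from ⟨by linarith, hlarge⟩)
  have hτ' : τ ≠ 1 := by
    rintro rfl
    linarith
  refine ⟨τ, lt_of_le_of_ne hτ1 hτ'.symm, by linarith, ?_⟩
  filter_upwards [Ioo_mem_nhdsGT hδ0] with ε hε
  rw [hcongr τ ε δ (by linarith [hε.2]) (by linarith),
    hcongr 1 ε (ρ - 1) (by linarith [hε.2]) le_rfl]
  exact hτ

/-- Radii for which both coefficients of the first variation vanish in the limit. -/
theorem exists_critical_radii [Nontrivial (Euc n)] (hn : 1 ≤ n) (hs : 0 < s) (hs1 : s < 1) {e : Euc n}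
    (he : ‖e‖ = 1) :
    ∃ r₁ r₂ : ℝ, 0 < r₁ ∧ r₁ < 1 ∧ 1 < r₂ ∧
      (∀ᶠ ε in 𝓝[>] (0 : ℝ), pot (n + s) ε (ball 0 1) (r₂ • e) =
        2 * pot (n + s) ε (ball 0 r₁) (r₂ • e)) ∧
      Filter.Tendsto (fun ε => truncCurvature (n + s) ε r₁ e -
        2 * (truncMass n (n + s) ε - pot (n + s) ε (ball 0 r₂) (r₁ • e))) (𝓝[>] 0) (𝓝 0) := by
  obtain ⟨ρ, hρ, hρ'⟩ := exists_radius_compl hs he (half_pos (ballCurvature_pos hn hs hs1 he))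
  obtain ⟨τ, hτ, hτρ, hτ'⟩ := exists_radius_double hs he hρ
  have hτ0 : 0 < τ := by linarith
  have hc : 0 < τ⁻¹ := inv_pos.2 hτ0
  have hscale : Filter.Tendsto (fun ε : ℝ => τ * ε) (𝓝[>] 0) (𝓝[>] 0) :=
    tendsto_const_mul_nhdsGT_zero hτ0
  -- Dilation by `τ⁻¹` carries the balls of radii `1`, `τ`, `ρ` to those of radii `r₁`, `1`, `r₂`.
  -- Both equations are homogeneous, with the truncation `τ * ε` becoming `ε`.
  refine ⟨τ⁻¹, τ⁻¹ * ρ, hc, inv_lt_one_of_one_lt₀ hτ, ?_, ?_, ?_⟩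
  · rw [inv_mul_eq_div]
    exact (one_lt_div hτ0).2 hτρ
  · filter_upwards [hscale.eventually hτ'] with ε hε
    have h1 := pot_ball_smul (p := n + s) (ε := τ * ε) hc τ (ρ • e)
    have h2 := pot_ball_smul (p := n + s) (ε := τ * ε) hc 1 (ρ • e)
    rw [inv_mul_cancel₀ hτ0.ne', inv_mul_cancel_left₀ hτ0.ne', smul_smul] at h1
    rw [mul_one, inv_mul_cancel_left₀ hτ0.ne', smul_smul] at h2
    rw [h1, h2, hε]
    ring
  · have hlim := ((tendsto_truncCurvature hn hs hs1 he).sub_const (ballCurvature n s)).const_mul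
      (τ⁻¹ ^ ((n : ℝ) - (n + s)))
    rw [sub_self, mul_zero] at hlim
    refine (hlim.comp hscale).congr' ?_
    filter_upwards [hscale.eventually hρ'] with ε hε
    have h1 := pot_ball_smul (p := n + s) (ε := τ * ε) hc 1 e
    have h2 := pot_ball_smul (p := n + s) (ε := τ * ε) hc ρ e
    have h3 := truncMass_smul (n := n) (p := n + s) (ε := τ * ε) hc
    rw [mul_one, inv_mul_cancel_left₀ hτ0.ne'] at h1
    rw [inv_mul_cancel_left₀ hτ0.ne'] at h2 h3
    rw [Function.comp_apply, truncCurvature, truncCurvature, h1, h2, h3, one_smul]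
    linear_combination (2 * τ⁻¹ ^ ((n : ℝ) - (n + s))) * hε

end Radii

/-! ### The perimeter of the moving annulus and the conclusion. -/

section FreeBoundary

variable {n : ℕ} {L : ℝ} {T : ℝ → Euc n → Euc n} {p ε s : ℝ}

theorem interaction_singKer_eq_zero (hp : 0 ≤ p) (hε : 0 < ε) {U V : Set (Euc n)}
    (hU : MeasurableSet U) (hV : MeasurableSet V) (h : ∀ y ∈ U, ∀ x ∈ V, ε ≤ ‖x - y‖) :
    interaction (singKer p ε) U V = 0 := by
  rw [interaction_congr (k' := fun _ => 0) hU hV fun y hy x hx => singKer_of_le hp hε (h y hy x hx)]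
  simp [interaction]

/-- The truncated part of the perimeter of `B \ A` in `Ω`, when `A ⊆ Ω ⊆ B`. -/
def truncPerimeter (p ε : ℝ) (A B Ω : Set (Euc n)) : ℝ :=
  truncMass n p ε * (volume.real Ω - volume.real A) - energy p ε A A - energy p ε Ω B +
    2 * energy p ε A B

/-- Decomposition of the perimeter of an annular set in the unit ball into its truncated and
singular parts. -/
theorem fracPerimeter_annular (hs : 0 < s) {d : ℝ} (hε : 0 < ε) (hεd : ε ≤ d) {A B : Set (Euc n)}
    (hA : MeasurableSet A) (hB : MeasurableSet B) (hAd : A ⊆ ball 0 (1 - d))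
    (hBd : ball 0 (1 + d) ⊆ B) (hBf : volume B ≠ ⊤) :
    0 ≤ truncPerimeter (n + s) ε A B (ball 0 1) ∧
    fracPerimeter s (B \ A) (ball (0 : Euc n) 1) = ENNReal.ofReal (fracConst n s) *
      (ENNReal.ofReal (truncPerimeter (n + s) ε A B (ball 0 1)) +
        interaction (singKer (n + s) ε) A Aᶜ) := by
  have hp : (n : ℝ) < n + s := by linarith
  have hp0 : (0 : ℝ) ≤ n + s := by positivity
  set Ω : Set (Euc n) := ball 0 1 with hΩ
  have hΩm : MeasurableSet Ω := measurableSet_ball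
  have hΩf : volume Ω ≠ ⊤ := measure_ball_lt_top.ne
  have hAΩ : A ⊆ Ω := hAd.trans (ball_subset_ball (by linarith))
  have hΩB : Ω ⊆ B := (ball_subset_ball (by linarith)).trans hBd
  have hAf : volume A ≠ ⊤ := ne_top_of_le_ne_top hΩf (measure_mono hAΩ)
  have hAn : ∀ x ∈ A, ‖x‖ < 1 - d := fun x hx => by simpa using hAd hx
  have hΩn : ∀ x ∈ Ω, ‖x‖ < 1 := fun x hx => by simpa [hΩ] using hx
  have hΩcn : ∀ x ∈ Ωᶜ, 1 ≤ ‖x‖ := fun x hx => by simpa [hΩ] using hx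
  have hBcn : ∀ x ∈ Bᶜ, 1 + d ≤ ‖x‖ := fun x hx => by
    simpa using Set.notMem_subset hBd hx
  have e1 : (B \ A)ᶜ ∩ Ω = A := by
    ext x
    have := @hAΩ x
    have := @hΩB x
    simp only [Set.mem_inter_iff, Set.mem_compl_iff, Set.mem_sdiff]
    tauto
  have e2 : (B \ A) ∩ Ω = Ω \ A := by
    ext x
    have := @hΩB x
    simp only [Set.mem_inter_iff, Set.mem_sdiff]
    tauto
  have e3 : (B \ A)ᶜ ∩ Ωᶜ = Bᶜ := by
    ext x
    have := @hAΩ x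
    have := @hΩB x
    simp only [Set.mem_inter_iff, Set.mem_compl_iff, Set.mem_sdiff]
    tauto
  have e4 : (B \ A) ∩ Ωᶜ = B \ Ω := by
    ext x
    have := @hAΩ x
    simp only [Set.mem_inter_iff, Set.mem_compl_iff, Set.mem_sdiff]
    tauto
  have d1 : Disjoint A (Ω \ A) := disjoint_sdiff_self_right
  have d2 : Disjoint (Ω \ A) Bᶜ :=
    Set.disjoint_left.2 fun x hx hx' => hx' (hΩB hx.1)
  have d3 : Disjoint (B \ Ω) A := Set.disjoint_left.2 fun x hx hx' => hx.2 (hAΩ hx')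
  -- The gaps of width `d` separate every pair except `A` and `Ω \ A`, so only that pair feels the
  -- singular kernel. By `s4`, enlarging `Ω \ A` to `Aᶜ` costs nothing.
  have s2 : interaction (singKer (n + s) ε) (Ω \ A) Bᶜ = 0 :=
    interaction_singKer_eq_zero hp0 hε (hΩm.diff hA) hB.compl fun y hy x hx => by
      have := norm_sub_norm_le x y
      linarith [hΩn y hy.1, hBcn x hx]
  have s3 : interaction (singKer (n + s) ε) (B \ Ω) A = 0 :=
    interaction_singKer_eq_zero hp0 hε (hB.diff hΩm) hA fun y hy x hx => by
      have := norm_sub_norm_le y x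
      rw [norm_sub_rev] at this
      linarith [hAn x hx, hΩcn y hy.2]
  have s4 : interaction (singKer (n + s) ε) A Ωᶜ = 0 :=
    interaction_singKer_eq_zero hp0 hε hA hΩm.compl fun y hy x hx => by
      have := norm_sub_norm_le x y
      linarith [hAn y hy, hΩcn x hx]
  have s5 : interaction (singKer (n + s) ε) A Aᶜ = interaction (singKer (n + s) ε) A (Ω \ A) := by
    have : Aᶜ = (Ω \ A) ∪ Ωᶜ := by
      ext x
      have := @hAΩ x
      simp only [Set.mem_compl_iff, Set.mem_union, Set.mem_sdiff]
      tauto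
    rw [this, interaction_union_right (measurable_singKer _ _) A hΩm.compl
      (Set.disjoint_left.2 fun x hx hx' => hx' hx.1), s4, add_zero]
  have hQ : truncPerimeter (n + s) ε A B Ω = energy (n + s) ε A (Ω \ A) +
      energy (n + s) ε (Ω \ A) Bᶜ + energy (n + s) ε (B \ Ω) A := by
    rw [truncPerimeter, energy_diff_right hp hε hAf hA hAΩ,
      energy_compl_right hp hε (ne_top_of_le_ne_top hΩf (measure_mono Set.sdiff_subset)) hB,
      energy_diff_left hp hε hΩf hA hAΩ, energy_diff_left hp hε hBf hΩm hΩB,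
      measureReal_sdiff hAΩ hA hΩf, energy_comm hp hε hBf hAf, energy_comm hp hε hΩf hAf]
    ring
  have p1 := energy_nonneg (p := n + s) hε A (Ω \ A)
  have p2 := energy_nonneg (p := n + s) hε (Ω \ A) Bᶜ
  have p3 := energy_nonneg (p := n + s) hε (B \ Ω) A
  refine ⟨by rw [hQ]; positivity, ?_⟩
  rw [fracPerimeter, e1, e2, e3, e4, fracInteraction_eq, fracInteraction_eq, fracInteraction_eq,
    interaction_fracKer_eq_energy_add hp hε hA (hΩm.diff hA) hAf d1,
    interaction_fracKer_eq_energy_add hp hε (hΩm.diff hA) hB.compl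
      (ne_top_of_le_ne_top hΩf (measure_mono Set.sdiff_subset)) d2,
    interaction_fracKer_eq_energy_add hp hε (hB.diff hΩm) hA
      (ne_top_of_le_ne_top hBf (measure_mono Set.sdiff_subset)) d3, s2, s3, s5, hQ,
    ENNReal.ofReal_add (add_nonneg p1 p2) p3, ENNReal.ofReal_add p1 p2]
  ring

theorem LipschitzFlow.image_annulus (hT : LipschitzFlow L T) (t : ℝ) (A B : Set (Euc n)) :
    T t '' (B \ A) = T t '' B \ T t '' A := by
  simp [hT.image_eq_preimage]

theorem LipschitzFlow.eventually_image_ball_subset (hT : LipschitzFlow L T) {r R : ℝ}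
    (hrR : r < R) : ∀ᶠ t in 𝓝 (0 : ℝ), T t '' ball 0 r ⊆ ball 0 R := by
  filter_upwards [eventually_abs_lt one_pos,
    eventually_mul_abs_lt (L * (1 + r)) (sub_pos.2 hrR)] with t ht1 ht2 x hx
  rw [mem_ball_zero_iff]
  by_cases hxr : x ∈ ball (0 : Euc n) r
  · exact (mem_ball_zero_iff.1 hxr).trans hrR
  · linarith [(abs_le.1 (hT.mem_shell ht1.le (Or.inl ⟨hx, hxr⟩))).2]

theorem LipschitzFlow.eventually_ball_subset_image (hT : LipschitzFlow L T) {r R : ℝ}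
    (hrR : r < R) : ∀ᶠ t in 𝓝 (0 : ℝ), ball 0 r ⊆ T t '' ball 0 R := by
  filter_upwards [eventually_abs_lt one_pos,
    eventually_mul_abs_lt (L * (1 + R)) (sub_pos.2 hrR)] with t ht1 ht2 x hx
  by_contra hx'
  have h := (abs_le.1 (hT.mem_shell ht1.le (Or.inr ⟨ball_subset_ball hrR.le hx, hx'⟩))).1
  rw [mem_ball_zero_iff] at hx
  linarith

/-- Each moving ball contributes its boundary potential times its volume change. The self-energy of
the inner ball counts twice, and regrouping the mass term produces `truncCurvature`. -/
theorem LipschitzFlow.truncPerimeter_sub_isLittleO [Nontrivial (Euc n)] (hT : LipschitzFlow L T)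
    (hp : (n : ℝ) < p) (hε : 0 < ε) {r R ρ : ℝ} (hr : 0 < r) (hR : 0 < R) {e : Euc n}
    (he : ‖e‖ = 1) :
    (fun t => truncPerimeter p ε (T t '' ball 0 r) (T t '' ball 0 R) (ball 0 ρ) -
      truncPerimeter p ε (ball (0 : Euc n) r) (ball 0 R) (ball 0 ρ) -
      ((truncCurvature p ε r e - 2 * (truncMass n p ε - pot p ε (ball 0 R) (r • e))) *
        (volume.real (T t '' ball 0 r) - volume.real (ball (0 : Euc n) r)) +
      (2 * pot p ε (ball 0 r) (R • e) - pot p ε (ball 0 ρ) (R • e)) *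
        (volume.real (T t '' ball 0 R) - volume.real (ball (0 : Euc n) R))))
      =o[𝓝 0] fun t : ℝ => t := by
  have h1 := hT.energy_sub_isLittleO hp hε hr hr he
  have h2 := hT.energy_fixed_sub_isLittleO hp hε hR ρ he
  have h3 := hT.energy_sub_isLittleO hp hε hr hR he
  refine (((h3.const_mul_left 2).sub h1).sub h2).congr_left fun t => ?_
  have hb : ∀ τ, volume (ball (0 : Euc n) τ) ≠ ⊤ := fun τ => measure_ball_lt_top.ne
  rw [truncPerimeter, truncPerimeter, truncCurvature,
    energy_comm hp hε (hb ρ) (hT.volume_image_ne_top t R), energy_comm hp hε (hb ρ) (hb R)]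
  ring

theorem LipschitzFlow.fracPerimeter_annulus [Nontrivial (Euc n)] (hT : LipschitzFlow L T)
    (hs : 0 < s) (hs1 : s < 1) {r₁ r₂ : ℝ} (h0 : 0 < r₁) (h1 : r₁ < 1) (h2 : 1 < r₂) {e : Euc n}
    (he : ‖e‖ = 1)
    (hout : ∀ᶠ ε in 𝓝[>] (0 : ℝ), pot (n + s) ε (ball 0 1) (r₂ • e) =
        2 * pot (n + s) ε (ball 0 r₁) (r₂ • e))
    (hin : Filter.Tendsto (fun ε => truncCurvature (n + s) ε r₁ e -
        2 * (truncMass n (n + s) ε - pot (n + s) ε (ball 0 r₂) (r₁ • e))) (𝓝[>] 0) (𝓝 0)) :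
    (∀ᶠ t in 𝓝 (0 : ℝ),
      fracPerimeter s (T t '' (ball 0 r₂ \ ball 0 r₁)) (ball (0 : Euc n) 1) ≠ ⊤) ∧
    HasDerivAt (fun t =>
      (fracPerimeter s (T t '' (ball 0 r₂ \ ball 0 r₁)) (ball (0 : Euc n) 1)).toReal) 0 0 := by
  have hp : (n : ℝ) < n + s := by linarith
  have hp0 : (0 : ℝ) ≤ n + s := by positivity
  have hL := hT.nonneg
  obtain ⟨d, hd0, hd1, hd2⟩ : ∃ d : ℝ, 0 < d ∧ r₁ < 1 - d ∧ 1 + d < r₂ := by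
    refine ⟨min (1 - r₁) (r₂ - 1) / 2, ?_, ?_, ?_⟩
    · have := lt_min (sub_pos.2 h1) (sub_pos.2 h2)
      linarith
    · linarith [min_le_left (1 - r₁) (r₂ - 1)]
    · linarith [min_le_right (1 - r₁) (r₂ - 1)]
  have hfin := interaction_fracKer_ball_compl_ne_top (n := n) hs hs1 r₁
  set A : Set (Euc n) := ball 0 r₁ with hAdef
  set B : Set (Euc n) := ball 0 r₂ with hBdef
  have hAm : MeasurableSet A := measurableSet_ball
  have hBm : MeasurableSet B := measurableSet_ball
  have hsub := (hT.eventually_image_ball_subset hd1).and (hT.eventually_ball_subset_image hd2)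
  have hsmall := (eventually_mul_abs_lt L (show (0 : ℝ) < 1 / 2 by norm_num)).and
    (eventually_mul_abs_lt ((2 * n + (n + s)) * L) one_pos)
  set κ := (ENNReal.ofReal (fracConst n s)).toReal with hκ
  have hκ0 : 0 ≤ κ := ENNReal.toReal_nonneg
  -- the perimeter along the flow
  have hper : ∀ ε, 0 < ε → ε ≤ d → ∀ᶠ t in 𝓝 (0 : ℝ),
      fracPerimeter s (T t '' (B \ A)) (ball (0 : Euc n) 1) ≠ ⊤ ∧
      (fracPerimeter s (T t '' (B \ A)) (ball (0 : Euc n) 1)).toReal =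
        κ * (truncPerimeter (n + s) ε (T t '' A) (T t '' B) (ball 0 1) +
          (interaction (singKer (n + s) ε) (T t '' A) (T t '' A)ᶜ).toReal) := by
    intro ε hε hεd
    filter_upwards [hsub, hsmall] with t ⟨ht1, ht2⟩ ⟨ht3, ht4⟩
    rw [mul_assoc] at ht4
    obtain ⟨hQ, hP⟩ := fracPerimeter_annular hs hε hεd (hT.measurableSet_image t hAm)
      (hT.measurableSet_image t hBm) ht1 ht2 (hT.volume_image_ne_top t r₂)
    have hg := (abs_interaction_singKer_sub_le hT hp0 hε ht3.le ht4.le hAm hAm.compl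
      disjoint_compl_right hfin).1
    rw [hT.image_compl] at hg
    rw [hT.image_annulus, hP]
    refine ⟨ENNReal.mul_ne_top ENNReal.ofReal_ne_top
      (ENNReal.add_ne_top.2 ⟨ENNReal.ofReal_ne_top, hg⟩), ?_⟩
    rw [ENNReal.toReal_mul, ENNReal.toReal_add ENNReal.ofReal_ne_top hg, ENNReal.toReal_ofReal hQ]
  refine ⟨(hper d hd0 le_rfl).mono fun t ht => ht.1, ?_⟩
  rw [hasDerivAt_iff_isLittleO_nhds_zero, Asymptotics.isLittleO_iff]
  intro c hc
  obtain ⟨C, hC0, hC⟩ := hT.exists_volume_symmDiff_le h0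
  -- Three errors are budgeted: `η` for the singular part, `η` for the truncated remainder and `η *
  -- C` for the inner coefficient times the volume change. The `κ + 1` avoids dividing by `κ`, which
  -- is only known to be nonnegative.
  set η := c / ((κ + 1) * (C + 2)) with hη
  have hη0 : 0 < η := by positivity
  have h4 : Filter.Tendsto (fun ε : ℝ => 4 * ε) (𝓝[>] 0) (𝓝[>] 0) :=
    tendsto_const_mul_nhdsGT_zero four_pos
  have hN := ((tendsto_interaction_nearKer (show (0 : ℝ) < n + s by positivity) hfin).comp
    h4).const_mul (6 * ((2 * n + (n + s)) * L))
  rw [mul_zero] at hN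
  have hI : ∀ᶠ ε in 𝓝[>] (0 : ℝ), ε ∈ Set.Ioo 0 d := Ioo_mem_nhdsGT hd0
  -- The truncation is fixed before `t` tends to `0`: the outer coefficient vanishes exactly, while
  -- the inner coefficient and the singular rate are at most `η`.
  obtain ⟨ε, ⟨⟨hε, hεd⟩, hεN⟩, hεout, hεin⟩ := ((hI.and (hN.eventually_le_const hη0)).and
    (hout.and ((tendsto_zero_iff_norm_tendsto_zero.1 hin).eventually_le_const hη0))).exists
  rw [Function.comp_apply] at hεN
  have hz : (2 * pot (n + s) ε A (r₂ • e) - pot (n + s) ε (ball 0 1) (r₂ • e)) = 0 := by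
    rw [hεout, sub_self]
  have hlin := hT.truncPerimeter_sub_isLittleO (ρ := 1) hp hε h0 (show 0 < r₂ by linarith) he
  simp only [← hAdef, ← hBdef, hz, zero_mul, add_zero] at hlin
  set h := truncCurvature (n + s) ε r₁ e -
    2 * (truncMass n (n + s) ε - pot (n + s) ε B (r₁ • e))
  have hP0 := (hper ε hε hεd.le).self_of_nhds.2
  filter_upwards [hper ε hε hεd.le, hsmall, hC, Asymptotics.isLittleO_iff.1 hlin hη0]
    with t ⟨_, hPt⟩ ⟨ht3, ht4⟩ htC hto
  rw [mul_assoc] at ht4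
  have hg := (abs_interaction_singKer_sub_le hT hp0 hε ht3.le ht4.le hAm hAm.compl
    disjoint_compl_right hfin).2
  rw [hT.image_compl] at hg
  rw [zero_add, smul_zero, sub_zero, hPt, hP0, hT.image_zero, hT.image_zero, ← mul_sub, norm_mul,
    Real.norm_of_nonneg hκ0]
  rw [Real.norm_eq_abs, Real.norm_eq_abs] at hto
  rw [Real.norm_eq_abs, Real.norm_eq_abs]
  set Q := truncPerimeter (n + s) ε A B (ball 0 1)
  set Q' := truncPerimeter (n + s) ε (T t '' A) (T t '' B) (ball 0 1)
  set g := (interaction (singKer (n + s) ε) A Aᶜ).toReal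
  set g' := (interaction (singKer (n + s) ε) (T t '' A) (T t '' A)ᶜ).toReal
  set a := volume.real (T t '' A) - volume.real A
  set N := (interaction (nearKer (n + s) (4 * ε)) A Aᶜ).toReal
  have ha : |a| ≤ C * |t| := by
    have := abs_setIntegral_sub_le (f := fun _ => (1 : ℝ)) (c := 1) (hT.measurableSet_image t hAm)
      hAm (hT.volume_image_ne_top t r₁) measure_ball_lt_top.ne
      (integrableOn_const (hT.volume_image_ne_top t r₁))
      (integrableOn_const measure_ball_lt_top.ne) (by simp)
    simp only [setIntegral_const, smul_eq_mul, mul_one, one_mul] at this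
    exact this.trans htC
  have hga : |g' - g| ≤ η * |t| := hg.trans (by
    calc _ = 6 * ((2 * n + (n + s)) * L) * N * |t| := by ring
      _ ≤ η * |t| := by gcongr)
  have hha : |h * a| ≤ η * (C * |t|) := by
    rw [abs_mul]
    gcongr
    exact hεin
  have hsum : |Q' + g' - (Q + g)| ≤ η * (C + 2) * |t| := by
    calc |Q' + g' - (Q + g)| = |(Q' - Q - h * a) + h * a + (g' - g)| := by congr 1; ring
      _ ≤ |Q' - Q - h * a| + |h * a| + |g' - g| := abs_add_three _ _ _
      _ ≤ η * |t| + η * (C * |t|) + η * |t| := by gcongr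
      _ = η * (C + 2) * |t| := by ring
  calc κ * |Q' + g' - (Q + g)| ≤ (κ + 1) * (η * (C + 2) * |t|) := by
        gcongr
        linarith
    _ = c * |t| := by rw [hη]; field_simp

theorem disjoint_frontier_annulus {r₁ r₂ : ℝ} (h1 : r₁ < 1) (h2 : 1 < r₂) :
    Disjoint (frontier (ball (0 : Euc n) r₂ \ ball 0 r₁)) (frontier (ball (0 : Euc n) 1)) := by
  refine Set.disjoint_left.2 fun x hx hx1 => ?_
  have hx1' := frontier_ball_subset_sphere hx1
  rw [mem_sphere_zero_iff_norm] at hx1'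
  rw [Set.sdiff_eq] at hx
  rcases frontier_inter_subset _ _ hx with h | h
  · have := frontier_ball_subset_sphere h.1
    rw [mem_sphere_zero_iff_norm] at this
    linarith
  · rw [frontier_compl] at h
    have := frontier_ball_subset_sphere h.2
    rw [mem_sphere_zero_iff_norm] at this
    linarith

end FreeBoundary

theorem mainTheorem4 (n : ℕ) (hn : 1 ≤ n) :
    ∃ s₀ ∈ Set.Ioo (0 : ℝ) 1, ∀ s ∈ Set.Ioo (0 : ℝ) s₀,
      ∃ r₁ r₂ : ℝ, 0 < r₁ ∧ r₁ < 1 ∧ 1 < r₂ ∧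
        IsFreeBoundaryMinimal s (Metric.ball (0 : EuclideanSpace ℝ (Fin n)) 1)
          (Metric.ball (0 : EuclideanSpace ℝ (Fin n)) r₂ \
            Metric.ball (0 : EuclideanSpace ℝ (Fin n)) r₁) ∧
        Disjoint
          (frontier (Metric.ball (0 : EuclideanSpace ℝ (Fin n)) r₂ \
            Metric.ball (0 : EuclideanSpace ℝ (Fin n)) r₁))
          (frontier (Metric.ball (0 : EuclideanSpace ℝ (Fin n)) 1)) := by
  have : Nontrivial (Euc n) :=
    Module.nontrivial_of_finrank_pos (R := ℝ) (by rw [finrank_euclideanSpace_fin]; omega)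
  obtain ⟨e, he⟩ := exists_norm_eq (Euc n) zero_le_one
  -- The value `1 / 2` is arbitrary: the construction of the radii and the variation argument use
  -- only `0 < s < 1`.
  refine ⟨1 / 2, by norm_num, fun s hs => ?_⟩
  have hs1 : s < 1 := by linarith [hs.2]
  obtain ⟨r₁, r₂, h0, h1, h2, hout, hin⟩ := exists_critical_radii hn hs.1 hs1 he
  refine ⟨r₁, r₂, h0, h1, h2, fun X Φ hX hΦ => ?_, disjoint_frontier_annulus h1 h2⟩
  obtain ⟨L, hT⟩ := hΦ.exists_lipschitzFlow hX.smooth hX.hasCompactSupport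
  exact hT.fracPerimeter_annulus hs.1 hs1 h0 h1 h2 he hout hin
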